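/- Let $r \ge s \ge 1$ be integers. Order pairs of positive integers componentwise and consider the finite posets $$R_{r,s}=[r]\times[s],\qquad RT_{r,s}=\{(i,j)\in R_{r+s-1,s} : i-j<r\},\qquad T_{r,s}=\{(i,j)\in RT_{r,s} : i+j>s\},$$ and, for $1\le k\le s$, $$I_k=T_{r,k}\cup\{(i,j)\in RT_{r,s} : k\le i\le r+k-1,\ k+1\le j\le s\},$$ so that $I_1=R_{r,s}$ and $I_s=T_{r,s}$. For $1\le k<s$ let $M_k$ be the interval $[(k,1),(r+k,k+1)]$ of $RT_{r,s}$. For a finite poset $P$ define the following (tropical) maps on $\mathbb R^P$. * $\psi(x)_p=\max\sum_{i=1}^n x_{q_i}$, the maximum being over all saturated chains $q_1\lessdot\cdots\lessdot q_n=p$ with $q_1$ minimal in $P$. The transfer map is $\psi^{-1}(x)_p=x_p-\max_{q\lessdot p}x_q$, where the maximum is read as $0$ if $p$ is minimal. * The toggle $\tau_p$ replaces $x_p$ by $-\max_{C}\sum_{q\in C}x_q$, where $C$ ranges over the maximal chains of $P$ containing $p$, and keeps all other coordinates. Antichain rowmotion is $\tilde\rho=\tau_{L^{-1}(n)}\circ\cdots\circ\tau_{L^{-1}(1)}$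 for a linear extension $L\colon P\to[n]$. For $1\le k<s$ define $\zeta_k\colon\mathbb R^{I_{k+1}}\to\mathbb R^{I_k}$ as follows. Given $x$, let $\bar x\in\mathbb R^{M_k}$ agree with $x$ on $M_k\setminus\{(k,1)\}\subset I_{k+1}$ and have an arbitrary fixed label $a_k\in\mathbb R$ at $(k,1)$. Let $\tilde\rho_k$ be antichain rowmotion on $M_k$ and put $$\zeta_k(x)_{ij}=\begin{cases}\tilde\rho_k^{-1}(\bar x)_{ij} & (i,j)\in I_k\cap M_k,\\ x_{i+1,j} & (i,j)\in I_k\setminus M_k,\ j>k+1,\\ x_{i,j+1} & (i,j)\in I_k\setminus M_k,\ i<k.\end{cases}$$ Let $\zeta=\zeta_1\circ\zeta_2\circ\cdots\circ\zeta_{s-1}\colon\mathbb R^{T_{r,s}}\to\mathbb R^{R_{r,s}}$. A plane partition of $P$ of height $\ell$ is an order-preserving labeling $P\to\mathbb Z_{\ge0}$ with maximum label $\ell$. A map between finite-dimensional real vector spaces is piecewise-linear if its domain is covered by finitely many polyhedra (finite intersections of closed half-spaces), on each of which the map agrees with an affine map. Then, for any choice of the linear extensions and of the labels $a_k$, the map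 $$\psi\circ\zeta\circ\psi^{-1}\colon\mathbb R^{T_{r,s}}\to\mathbb R^{R_{r,s}}$$ is continuous and piecewise-linear, and for every $\ell\in\mathbb Z_{\ge0}$ it restricts to a bijection from the plane partitions of $T_{r,s}$ of height $\ell$ to the plane partitions of $R_{r,s}$ of height $\ell$. In particular (Proctor's theorem), $R_{r,s}$ and $T_{r,s}$ have the same number of plane partitions of height $\ell$ for every $\ell\ge0$. -/

import Mathlib

/-! Tropical (max-plus) maps on labelings of finite posets, and the posets between the trapezoid and
the rectangle. -/

noncomputable section

namespace PosetLabeling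

section General

variable {P : Type*} [PartialOrder P] [Fintype P]

/-- The maximal chains of the induced subposet on `S`. -/
def maxChains (S : Set P) : Set (Finset P) :=
  {C | Maximal (fun D : Finset P => (D : Set P) ⊆ S ∧ IsChain (· ≤ ·) (D : Set P)) C}

/-- The tropical total weight `max_{C ∈ 𝒞} ∑_{q ∈ C} x_q` of a collection of subsets of `P`.
It is only used for nonempty collections, which are finite since `P` is. -/
def maxWeight (𝒞 : Set (Finset P)) (x : P → ℝ) : ℝ := ⨆ C : 𝒞, ∑ q ∈ C.1, x q

/-- The maximal chains of `P` that contain `p`. -/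
def maxChainsThrough (p : P) : Set (Finset P) := {C | C ∈ maxChains (Set.univ : Set P) ∧ p ∈ C}

/-- The tropical map `ψ`: the value at `p` is the maximal weight of a chain
`q₁ ⋖ q₂ ⋖ ⋯ ⋖ qₙ = p` with `q₁` minimal in `P`, that is, of a maximal chain of `{q | q ≤ p}`. -/
def psi (x : P → ℝ) : P → ℝ := fun p => maxWeight (maxChains (Set.Iic p)) x

open Classical in
/-- The tropical transfer map `ψ⁻¹`: the value at `p` is `x_p - max_{q ⋖ p} x_q`, where a minimal
element of `P` covers only the added bottom element, whose label is `0`. -/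
def transferMap (x : P → ℝ) : P → ℝ := fun p =>
  x p - (if IsMin p then 0 else ⨆ q : {q : P // q ⋖ p}, x q)

theorem maxChainsThrough_nonempty (p : P) : (maxChainsThrough p).Nonempty := by
  obtain ⟨C, hC, hmax⟩ := (Set.toFinite {D : Finset P | (D : Set P) ⊆ Set.univ ∧
    IsChain (· ≤ ·) (D : Set P)}).exists_le_maximal (a := {p}) (by simp)
  exact ⟨C, hmax, hC (Finset.mem_singleton_self p)⟩

variable [DecidableEq P]

/-- The tropical antichain toggle at `p` as a function: the coordinate at `p` is replaced by minus
the maximal weight of a maximal chain through `p`. -/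
def toggleFun (p : P) (x : P → ℝ) : P → ℝ :=
  Function.update x p (-maxWeight (maxChainsThrough p) x)

theorem maxWeight_update (p : P) (x : P → ℝ) (v : ℝ) :
    maxWeight (maxChainsThrough p) (Function.update x p v) =
      maxWeight (maxChainsThrough p) x + (v - x p) := by
  have := (maxChainsThrough_nonempty p).to_subtype
  unfold maxWeight
  rw [ciSup_add (Set.finite_range _).bddAbove]
  congr 1
  funext C
  rw [Finset.sum_update_of_mem C.2.2, ← Finset.add_sum_erase _ _ C.2.2,
    Finset.sdiff_singleton_eq_erase]
  ring

theorem toggleFun_involutive (p : P) : Function.Involutive (toggleFun p) := by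
  intro x
  unfold toggleFun
  rw [maxWeight_update]
  simp

/-- The tropical antichain toggle at `p`, which is an involution. -/
def toggle (p : P) : Equiv.Perm (P → ℝ) := (toggleFun_involutive p).toPerm

variable (P) in
/-- A linear extension: an order-preserving bijection from `P` to a chain with as many elements. -/
def LinExt : Type _ := {L : P ≃ Fin (Fintype.card P) // Monotone L}

/-- Tropical antichain rowmotion `τ_{L⁻¹(n)} ∘ ⋯ ∘ τ_{L⁻¹(1)}`: toggle once at each element, from
bottom to top. (The product in `Equiv.Perm` is composition.) -/
def rowmotion (L : LinExt P) : Equiv.Perm (P → ℝ) :=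
  (List.ofFn fun i => toggle (L.1.symm i)).reverse.prod

/-- The plane partitions of `P` of height `ℓ`: order-preserving labelings by nonnegative integers
whose maximum label is `ℓ`. -/
def planePartitions (P : Type*) [PartialOrder P] (ℓ : ℕ) : Set (P → ℕ) :=
  {x | Monotone x ∧ IsGreatest (Set.range x) ℓ}

/-- An integer labeling, seen as a real labeling. -/
def toReal {P : Type*} (x : P → ℕ) : P → ℝ := fun p => (x p : ℝ)

end General

section PiecewiseLinear

variable {E F : Type*} [AddCommGroup E] [Module ℝ E] [AddCommGroup F] [Module ℝ F]

/-- A polyhedron: an intersection of finitely many closed half-spaces. -/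
def IsPolyhedron (S : Set E) : Prop :=
  ∃ H : Finset (Module.Dual ℝ E × ℝ), S = {x | ∀ h ∈ H, h.1 x ≤ h.2}

/-- `f` is piecewise-linear: finitely many polyhedra cover the space, and on each of them `f` agrees
with an affine map. -/
def IsPiecewiseLinear (f : E → F) : Prop :=
  ∃ 𝒮 : Set (Set E), 𝒮.Finite ∧ (∀ S ∈ 𝒮, IsPolyhedron S) ∧ ⋃₀ 𝒮 = Set.univ ∧
    ∀ S ∈ 𝒮, ∃ g : E →ᵃ[ℝ] F, Set.EqOn f g S

end PiecewiseLinear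

/-- The rectangle poset `[r] × [s]`. All finite sets of pairs below carry the componentwise order. -/
def rect (r s : ℕ) : Finset (ℕ × ℕ) := Finset.Icc (1, 1) (r, s)

/-- The right trapezoid poset: the pairs `(i, j)` in `[r + s - 1] × [s]` with `i - j < r`. -/
def rightTrap (r s : ℕ) : Finset (ℕ × ℕ) := (rect (r + s - 1) s).filter fun p => p.1 < r + p.2

/-- The trapezoid poset: the pairs `(i, j)` in the right trapezoid with `i + j > s`. -/
def trap (r s : ℕ) : Finset (ℕ × ℕ) := (rightTrap r s).filter fun p => s < p.1 + p.2

/-- The `k`-th intermediate poset, for `1 ≤ k ≤ s`. -/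
def inter (r s k : ℕ) : Finset (ℕ × ℕ) :=
  (rightTrap r s).filter fun p => p ∈ trap r k ∨ p ∈ Finset.Icc (k, k + 1) (r + k - 1, s)

theorem inter_one (r s : ℕ) (hs : 1 ≤ s) : inter r s 1 = rect r s := by
  ext ⟨i, j⟩
  simp only [inter, trap, rightTrap, rect, Finset.mem_filter, Finset.mem_Icc, Prod.mk_le_mk]
  omega

theorem inter_self (r s : ℕ) : inter r s s = trap r s := by
  ext ⟨i, j⟩
  simp only [inter, trap, rightTrap, rect, Finset.mem_filter, Finset.mem_Icc, Prod.mk_le_mk]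
  omega

/-- The interval `[(k, 1), (r + k, k + 1)]` of the right trapezoid, for `1 ≤ k < s`. -/
def mid (r s k : ℕ) : Finset (ℕ × ℕ) :=
  (rightTrap r s).filter fun p => p ∈ Finset.Icc (k, 1) (r + k, k + 1)

/-- The label of `x` at the position `p`. (The value `0` outside `S` is a dummy value: for
`1 ≤ k < s` the maps below read only positions inside.) -/
def label {S : Finset (ℕ × ℕ)} (x : S → ℝ) (p : ℕ × ℕ) : ℝ := if h : p ∈ S then x ⟨p, h⟩ else 0

/-- The restriction of `x` to `mid r s k` without its minimum `(k, 1)`, where the label is `a`. -/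
def bar {r s k : ℕ} (a : ℝ) (x : inter r s (k + 1) → ℝ) : mid r s k → ℝ :=
  fun p => if p.1 = (k, 1) then a else label x p.1

/-- The tropical map `ζ_k`: inverse antichain rowmotion inside `mid r s k`, while labels above are
shifted southeast and labels below are shifted southwest. -/
def zetaStep {r s : ℕ} (k : ℕ) (L : LinExt (mid r s k)) (a : ℝ) (x : inter r s (k + 1) → ℝ) :
    inter r s k → ℝ := fun p =>
  if h : p.1 ∈ mid r s k then (rowmotion L).symm (bar a x) ⟨p.1, h⟩
  else if k + 1 < p.1.2 then label x (p.1.1 + 1, p.1.2)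
  else label x (p.1.1, p.1.2 + 1)

/-- The composition `ζ_1 ∘ ζ_2 ∘ ⋯ ∘ ζ_n`. -/
def zetaComp {r s : ℕ} (L : ∀ k, LinExt (mid r s k)) (a : ℕ → ℝ) :
    (n : ℕ) → (inter r s (n + 1) → ℝ) → inter r s 1 → ℝ
  | 0, x => x
  | n + 1, x => zetaComp L a n (zetaStep (n + 1) (L (n + 1)) (a (n + 1)) x)

/-- The tropical map `ζ = ζ_1 ∘ ⋯ ∘ ζ_{s-1}` from labelings of the trapezoid (the last intermediate
poset) to labelings of the rectangle (the first one). -/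
def zeta {r s : ℕ} (L : ∀ k, LinExt (mid r s k)) (a : ℕ → ℝ) (x : trap r s → ℝ) :
    rect r s → ℝ := fun p =>
  label (zetaComp L a (s - 1) fun q => label x q.1) p.1

end PosetLabeling

end

open PosetLabeling

set_option linter.unusedSectionVars false

noncomputable section

namespace PosetLabeling

/-! ### Maximal chains below, above and through an element. -/

section Chains

variable {P : Type*} [PartialOrder P]

/-! `psi` and `transferMap` are inverse to each other. On a poset with a greatest element, `psi`
identifies the labelings by nonnegative integers of maximal chain weight `ℓ` with the plane
partitions of height `ℓ`. So it is enough that `zeta` restricts to a bijection between the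
nonnegative integer labelings of trapezoid and rectangle, and that it preserves the maximal chain
weight. Piecewise-linearity, and with it continuity, is formal: all maps are composed of maxima of
linear functions.

Rowmotion enters only through the identity `psi (rowmotion L y) p + copsi y p = 0`
(`psi_rowmotion_add_copsi`). Differences along covers express the labels of `y` through `psi` of its
image and conversely, which gives integrality and nonnegativity away from the extreme elements of
`mid r s k`. At the minimum the identity also trades the fixed label `a` for the unknown label at
the maximum, so each `zetaStep` is bijective on such labelings.

For the weights, the max-plus numbers are treated as a commutative semiring, where maximal chain
weights are sums over lattice paths. The invariant (`pathTotal`) counts the paths from `(k, 1)`,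
plus those from `(i, k + 1 - i)` with `i < k` that meet the diagonal `i + 1 = r + j`. For `k = 1`
this is the weight of the rectangle. For `k = s` every path meets the diagonal, so it is the weight
of the trapezoid. The invariance (`StepData.pathTotal_eq`) is a conservation law. Let `D` sum over
the paths from the minimum of the middle part before the step and `E` over the paths to its maximum
after it; the rowmotion identity reads `D * E = 1`. The products of `D` with the old path sums form
a flow without sources or sinks away from the minimum. The new path sums are `E` times the flow that
goes up to the right of a point (paths avoiding the diagonal) or to its left (paths meeting it). No
subtraction is used, so the argument is valid tropically. -/

theorem mem_maxChains {S : Set P} {C : Finset P} : C ∈ maxChains S ↔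
    ((∀ q ∈ C, q ∈ S) ∧ ∀ q ∈ C, ∀ q' ∈ C, q ≤ q' ∨ q' ≤ q) ∧
      ∀ z ∈ S, (∀ q ∈ C, q ≤ z ∨ z ≤ q) → z ∈ C := by
  classical
  have key : ∀ D : Finset P, IsChain (· ≤ ·) (D : Set P) ↔
      ∀ q ∈ D, ∀ q' ∈ D, q ≤ q' ∨ q' ≤ q := by
    intro D
    refine ⟨fun h q hq q' hq' => h.total hq hq', fun h q hq q' hq' _ => h q hq q' hq'⟩
  constructor
  · rintro ⟨⟨h1, h2⟩, h3⟩
    refine ⟨⟨fun q hq => h1 hq, (key C).1 h2⟩, fun z hz hC => ?_⟩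
    refine h3 (y := insert z C) ⟨?_, ?_⟩ (by simp) (by simp)
    · intro q hq
      rcases Finset.mem_insert.1 hq with rfl | hq
      · exact hz
      · exact h1 hq
    · rw [key]
      have h2' := (key C).1 h2
      simp only [Finset.mem_insert]
      rintro q (rfl | hq) q' (rfl | hq')
      · exact Or.inl le_rfl
      · exact (hC _ hq').symm
      · exact hC _ hq
      · exact h2' _ hq _ hq'
  · rintro ⟨⟨h1, h2⟩, h3⟩
    refine ⟨⟨fun q hq => h1 q hq, (key C).2 h2⟩, fun D hD hCD z hz => ?_⟩
    exact h3 z (hD.1 hz) fun q hq => (key D).1 hD.2 q (hCD hq) z hz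

theorem maxChains_orderDual (S : Set P) : maxChains (P := Pᵒᵈ) S = maxChains S := by
  ext C
  refine (mem_maxChains (P := Pᵒᵈ)).trans (Iff.trans ?_ mem_maxChains.symm)
  refine and_congr (and_congr Iff.rfl ⟨fun h q hq q' hq' => (h q hq q' hq').symm,
    fun h q hq q' hq' => (h q hq q' hq').symm⟩) (forall₂_congr fun z _ => imp_congr ?_ Iff.rfl)
  exact forall₂_congr fun q _ => or_comm

theorem mem_of_mem_maxChains_Iic {p : P} {C : Finset P} (h : C ∈ maxChains (Set.Iic p)) :
    p ∈ C := by
  rw [mem_maxChains] at h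
  exact h.2 p le_rfl fun q hq => Or.inl (h.1.1 q hq)

theorem mem_of_mem_maxChains_Ici {p : P} {C : Finset P} (h : C ∈ maxChains (Set.Ici p)) :
    p ∈ C := by
  rw [mem_maxChains] at h
  exact h.2 p le_rfl fun q hq => Or.inr (h.1.1 q hq)

theorem maxChains_nonempty [Finite P] (S : Set P) : (maxChains S).Nonempty := by
  obtain ⟨C, -, hmax⟩ := (Set.toFinite {D : Finset P | (D : Set P) ⊆ S ∧
    IsChain (· ≤ ·) (D : Set P)}).exists_le_maximal (a := ∅) (by simp)
  exact ⟨C, hmax⟩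

theorem insert_mem_maxChains [DecidableEq P] {p q : P} (hqp : q ⋖ p) {C : Finset P}
    (h : C ∈ maxChains (Set.Iic q)) : insert p C ∈ maxChains (Set.Iic p) := by
  have hq := mem_of_mem_maxChains_Iic h
  rw [mem_maxChains] at h ⊢
  obtain ⟨⟨h1, h2⟩, h3⟩ := h
  have h1' : ∀ z ∈ C, z ≤ p := fun z hz => (h1 z hz).trans hqp.le
  simp only [Finset.mem_insert]
  refine ⟨⟨?_, ?_⟩, ?_⟩
  · rintro z (rfl | hz)
    exacts [le_rfl, h1' z hz]
  · rintro z (rfl | hz) z' (rfl | hz')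
    · exact Or.inl le_rfl
    · exact Or.inr (h1' z' hz')
    · exact Or.inl (h1' z hz)
    · exact h2 z hz z' hz'
  · intro z hz hC
    by_cases hzp : z = p
    · exact Or.inl hzp
    right
    have hzq : z ≤ q := by
      rcases hC q (Or.inr hq) with h | h
      · rcases h.eq_or_lt with rfl | h
        · exact le_rfl
        · exact absurd (lt_of_le_of_ne hz hzp) (hqp.2 h)
      · exact h
    exact h3 z hzq fun y hy => hC y (Or.inr hy)

theorem exists_erase_mem_maxChains [DecidableEq P] {p : P} (hp : ¬ IsMin p) {C : Finset P}
    (h : C ∈ maxChains (Set.Iic p)) : ∃ q, q ⋖ p ∧ C.erase p ∈ maxChains (Set.Iic q) := by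
  have hpC := mem_of_mem_maxChains_Iic h
  rw [mem_maxChains] at h
  obtain ⟨⟨h1, h2⟩, h3⟩ := h
  have hne : (C.erase p).Nonempty := by
    by_contra hC
    rw [Finset.not_nonempty_iff_eq_empty, Finset.erase_eq_empty_iff] at hC
    rcases hC with hC | hC
    · simp [hC] at hpC
    obtain ⟨z, hz⟩ := not_isMin_iff.1 hp
    have := h3 z hz.le (by simp [hC, hz.le])
    rw [hC, Finset.mem_singleton] at this
    exact hz.ne this
  obtain ⟨q, hq, hmax⟩ := (C.erase p).exists_maximal hne
  have hqC := Finset.mem_of_mem_erase hq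
  have hlt : q < p := lt_of_le_of_ne (h1 q hqC) (Finset.ne_of_mem_erase hq)
  have hle : ∀ z ∈ C.erase p, z ≤ q := fun z hz => by
    rcases h2 z (Finset.mem_of_mem_erase hz) q hqC with h | h
    exacts [h, hmax hz h]
  refine ⟨q, ⟨hlt, fun z hqz hzp => ?_⟩, ?_⟩
  · have hzC : z ∈ C := h3 z hzp.le fun y hy => by
      by_cases hyp : y = p
      · exact Or.inr (hyp ▸ hzp.le)
      · exact Or.inl ((hle y (Finset.mem_erase.2 ⟨hyp, hy⟩)).trans hqz.le)
    exact absurd (hle z (Finset.mem_erase.2 ⟨hzp.ne, hzC⟩)) hqz.not_ge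
  · rw [mem_maxChains]
    refine ⟨⟨hle, fun z hz z' hz' => h2 z (Finset.mem_of_mem_erase hz) z'
      (Finset.mem_of_mem_erase hz')⟩, fun z hz hzC => ?_⟩
    have hzp : z < p := lt_of_le_of_lt hz hlt
    refine Finset.mem_erase.2 ⟨hzp.ne, h3 z hzp.le fun y hy => ?_⟩
    by_cases hyp : y = p
    · exact Or.inr (hyp ▸ hzp.le)
    · exact hzC y (Finset.mem_erase.2 ⟨hyp, hy⟩)

theorem filter_le_mem_maxChains [DecidableLE P] {p : P} {C : Finset P}
    (h : C ∈ maxChainsThrough p) : C.filter (· ≤ p) ∈ maxChains (Set.Iic p) := by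
  obtain ⟨h, hp⟩ := h
  rw [mem_maxChains] at h ⊢
  obtain ⟨⟨-, h2⟩, h3⟩ := h
  simp only [Finset.mem_filter]
  refine ⟨⟨fun q hq => hq.2, fun q hq q' hq' => h2 q hq.1 q' hq'.1⟩, fun z hz hC => ⟨?_, hz⟩⟩
  refine h3 z trivial fun q hq => ?_
  rcases h2 q hq p hp with h | h
  · exact hC q ⟨hq, h⟩
  · exact Or.inr (le_trans hz h)

theorem filter_ge_mem_maxChains [DecidableLE P] {p : P} {C : Finset P}
    (h : C ∈ maxChainsThrough p) : C.filter (p ≤ ·) ∈ maxChains (Set.Ici p) := by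
  obtain ⟨h, hp⟩ := h
  rw [mem_maxChains] at h ⊢
  obtain ⟨⟨-, h2⟩, h3⟩ := h
  simp only [Finset.mem_filter]
  refine ⟨⟨fun q hq => hq.2, fun q hq q' hq' => h2 q hq.1 q' hq'.1⟩, fun z hz hC => ⟨?_, hz⟩⟩
  refine h3 z trivial fun q hq => ?_
  rcases h2 q hq p hp with h | h
  · exact Or.inl (le_trans h hz)
  · exact hC q ⟨hq, h⟩

theorem union_mem_maxChainsThrough [DecidableEq P] {p : P} {C₁ C₂ : Finset P}
    (h₁ : C₁ ∈ maxChains (Set.Iic p)) (h₂ : C₂ ∈ maxChains (Set.Ici p)) :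
    C₁ ∪ C₂ ∈ maxChainsThrough p := by
  have hp := mem_of_mem_maxChains_Iic h₁
  refine ⟨?_, Finset.mem_union_left _ hp⟩
  rw [mem_maxChains] at h₁ h₂ ⊢
  obtain ⟨⟨a1, a2⟩, a3⟩ := h₁
  obtain ⟨⟨b1, b2⟩, b3⟩ := h₂
  simp only [Finset.mem_union]
  refine ⟨⟨fun _ _ => trivial, ?_⟩, ?_⟩
  · rintro q (hq | hq) q' (hq' | hq')
    · exact a2 q hq q' hq'
    · exact Or.inl (le_trans (a1 q hq) (b1 q' hq'))
    · exact Or.inr (le_trans (a1 q' hq') (b1 q hq))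
    · exact b2 q hq q' hq'
  · intro z _ hz
    rcases hz p (Or.inl hp) with h | h
    · exact Or.inr (b3 z h fun q hq => hz q (Or.inr hq))
    · exact Or.inl (a3 z h fun q hq => hz q (Or.inl hq))

end Chains

/-! ### Maximal chain weights and their recursions along covers. -/

section Weights

variable {P : Type*} [PartialOrder P] [Fintype P]

theorem le_maxWeight {𝒞 : Set (Finset P)} {C : Finset P} (hC : C ∈ 𝒞) (x : P → ℝ) :
    ∑ q ∈ C, x q ≤ maxWeight 𝒞 x :=
  le_ciSup (f := fun C : 𝒞 => ∑ q ∈ C.1, x q) (Set.finite_range _).bddAbove ⟨C, hC⟩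

theorem exists_maxWeight_eq {𝒞 : Set (Finset P)} (h : 𝒞.Nonempty) (x : P → ℝ) :
    ∃ C ∈ 𝒞, maxWeight 𝒞 x = ∑ q ∈ C, x q := by
  have := h.to_subtype
  obtain ⟨C, hC⟩ := exists_eq_ciSup_of_finite (f := fun C : 𝒞 => ∑ q ∈ C.1, x q)
  exact ⟨C.1, C.2, hC.symm⟩

theorem maxWeight_le {𝒞 : Set (Finset P)} (h : 𝒞.Nonempty) {x : P → ℝ} {w : ℝ}
    (hw : ∀ C ∈ 𝒞, ∑ q ∈ C, x q ≤ w) : maxWeight 𝒞 x ≤ w := by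
  obtain ⟨C, hC, h⟩ := exists_maxWeight_eq h x
  exact h ▸ hw C hC

theorem maxWeight_congr {𝒞 : Set (Finset P)} {x y : P → ℝ}
    (h : ∀ C ∈ 𝒞, ∀ q ∈ C, x q = y q) : maxWeight 𝒞 x = maxWeight 𝒞 y := by
  unfold maxWeight
  congr 1
  funext C
  exact Finset.sum_congr rfl (h C.1 C.2)

theorem maxWeight_update_of_forall_mem [DecidableEq P] {𝒞 : Set (Finset P)} (hne : 𝒞.Nonempty)
    {p : P} (hp : ∀ C ∈ 𝒞, p ∈ C) (x : P → ℝ) (v : ℝ) :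
    maxWeight 𝒞 (Function.update x p v) = maxWeight 𝒞 x + (v - x p) := by
  have := hne.to_subtype
  unfold maxWeight
  rw [ciSup_add (Set.finite_range _).bddAbove]
  congr 1
  funext C
  rw [Finset.sum_update_of_mem (hp C.1 C.2), ← Finset.add_sum_erase _ _ (hp C.1 C.2),
    Finset.sdiff_singleton_eq_erase]
  ring

/-- The tropical map dual to `psi`: the maximal weight of a saturated chain from `p` to a maximal
element. -/
def copsi (x : P → ℝ) : P → ℝ := fun p => maxWeight (maxChains (Set.Ici p)) x

theorem copsi_eq_psi_orderDual (x : P → ℝ) (p : P) : copsi x p = psi (P := Pᵒᵈ) x p := by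
  unfold copsi psi
  have : maxChains (P := Pᵒᵈ) (Set.Iic p) = maxChains (Set.Ici p : Set P) :=
    maxChains_orderDual (Set.Ici p)
  rw [this]
  rfl

theorem psi_of_isMin {p : P} (hp : IsMin p) (x : P → ℝ) : psi x p = x p := by
  have key : ∀ C ∈ maxChains (Set.Iic p), ∑ q ∈ C, x q = x p := by
    intro C hC
    have : C = {p} := by
      refine Finset.eq_singleton_iff_unique_mem.2 ⟨mem_of_mem_maxChains_Iic hC, fun q hq => ?_⟩
      exact hp.eq_of_le ((mem_maxChains.1 hC).1.1 q hq)
    rw [this, Finset.sum_singleton]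
  obtain ⟨C, hC, h⟩ := exists_maxWeight_eq (maxChains_nonempty (Set.Iic p)) x
  exact h.trans (key C hC)

theorem add_psi_le {p q : P} (h : q ⋖ p) (x : P → ℝ) : x p + psi x q ≤ psi x p := by
  classical
  obtain ⟨C, hC, hw⟩ := exists_maxWeight_eq (maxChains_nonempty (Set.Iic q)) x
  have hp : p ∉ C := fun hp => h.lt.not_ge ((mem_maxChains.1 hC).1.1 p hp)
  unfold psi
  rw [hw, ← Finset.sum_insert hp]
  exact le_maxWeight (insert_mem_maxChains h hC) x

theorem exists_psi_eq {p : P} (hp : ¬ IsMin p) (x : P → ℝ) :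
    ∃ q, q ⋖ p ∧ psi x p = x p + psi x q := by
  classical
  obtain ⟨C, hC, hw⟩ := exists_maxWeight_eq (maxChains_nonempty (Set.Iic p)) x
  obtain ⟨q, hq, hCq⟩ := exists_erase_mem_maxChains hp hC
  refine ⟨q, hq, le_antisymm ?_ (add_psi_le hq x)⟩
  have h := le_maxWeight hCq x
  unfold psi
  rw [hw, ← Finset.add_sum_erase _ _ (mem_of_mem_maxChains_Iic hC)]
  linarith

theorem copsi_of_isMax {p : P} (hp : IsMax p) (x : P → ℝ) : copsi x p = x p := by
  rw [copsi_eq_psi_orderDual]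
  exact psi_of_isMin (P := Pᵒᵈ) (p := p) hp x

theorem add_copsi_le {p q : P} (h : p ⋖ q) (x : P → ℝ) : x p + copsi x q ≤ copsi x p := by
  rw [copsi_eq_psi_orderDual, copsi_eq_psi_orderDual]
  exact add_psi_le (P := Pᵒᵈ) (p := p) (q := q) h.toDual x

theorem exists_copsi_eq {p : P} (hp : ¬ IsMax p) (x : P → ℝ) :
    ∃ q, p ⋖ q ∧ copsi x p = x p + copsi x q := by
  obtain ⟨q, hq, h⟩ := exists_psi_eq (P := Pᵒᵈ) (p := p) hp x
  exact ⟨q, hq.ofDual, (copsi_eq_psi_orderDual x p).trans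
    (h.trans (congrArg (x p + ·) (copsi_eq_psi_orderDual x q).symm))⟩

theorem psi_congr {p : P} {x y : P → ℝ} (h : ∀ q ≤ p, x q = y q) : psi x p = psi y p :=
  maxWeight_congr fun _ hC q hq => h q ((mem_maxChains.1 hC).1.1 q hq)

theorem copsi_congr {p : P} {x y : P → ℝ} (h : ∀ q, p ≤ q → x q = y q) :
    copsi x p = copsi y p :=
  maxWeight_congr fun _ hC q hq => h q ((mem_maxChains.1 hC).1.1 q hq)

/-- Every chain counted by `psi x p` contains `p`, so the label at `p` enters additively and
cancels. -/
theorem psi_sub_congr {p : P} {x y : P → ℝ} (h : ∀ q < p, x q = y q) :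
    psi x p - x p = psi y p - y p := by
  classical
  have : psi x p = psi (Function.update y p (x p)) p := psi_congr fun q hq => by
    rcases hq.eq_or_lt with rfl | hq
    · simp
    · rw [Function.update_of_ne hq.ne, h q hq]
  rw [this]
  unfold psi
  rw [maxWeight_update_of_forall_mem (maxChains_nonempty _)
    fun C hC => mem_of_mem_maxChains_Iic hC]
  ring

/-- Cutting a maximal chain at `p` gives a lower and an upper half that can be chosen independently;
they share `p`, which is counted twice. -/
theorem maxWeight_maxChainsThrough (p : P) (x : P → ℝ) :
    maxWeight (maxChainsThrough p) x = psi x p + copsi x p - x p := by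
  classical
  apply le_antisymm
  · refine maxWeight_le (maxChainsThrough_nonempty p) fun C hC => ?_
    have h1 := le_maxWeight (filter_le_mem_maxChains hC) x
    have h2 := le_maxWeight (filter_ge_mem_maxChains hC) x
    have h3 : C.filter (· ≤ p) ∪ C.filter (p ≤ ·) = C := by
      rw [← Finset.filter_or]
      exact Finset.filter_true_of_mem fun q hq => (mem_maxChains.1 hC.1).1.2 q hq p hC.2
    have h4 : C.filter (· ≤ p) ∩ C.filter (p ≤ ·) = {p} := by
      ext q
      simp only [Finset.mem_inter, Finset.mem_filter, Finset.mem_singleton]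
      refine ⟨fun h => le_antisymm h.1.2 h.2.2, ?_⟩
      rintro rfl
      exact ⟨⟨hC.2, le_rfl⟩, hC.2, le_rfl⟩
    have h5 := Finset.sum_union_inter (s₁ := C.filter (· ≤ p)) (s₂ := C.filter (p ≤ ·)) (f := x)
    rw [h3, h4, Finset.sum_singleton] at h5
    unfold psi copsi
    linarith
  · obtain ⟨C₁, hC₁, h1⟩ := exists_maxWeight_eq (maxChains_nonempty (Set.Iic p)) x
    obtain ⟨C₂, hC₂, h2⟩ := exists_maxWeight_eq (maxChains_nonempty (Set.Ici p)) x
    have h3 := le_maxWeight (union_mem_maxChainsThrough hC₁ hC₂) x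
    have h4 : C₁ ∩ C₂ = {p} := by
      ext q
      simp only [Finset.mem_inter, Finset.mem_singleton]
      refine ⟨fun h => le_antisymm ((mem_maxChains.1 hC₁).1.1 q h.1)
        ((mem_maxChains.1 hC₂).1.1 q h.2), ?_⟩
      rintro rfl
      exact ⟨mem_of_mem_maxChains_Iic hC₁, mem_of_mem_maxChains_Ici hC₂⟩
    have h5 := Finset.sum_union_inter (s₁ := C₁) (s₂ := C₂) (f := x)
    rw [h4, Finset.sum_singleton] at h5
    unfold psi copsi
    linarith

theorem psi_of_isTop {t : P} (ht : IsTop t) (x : P → ℝ) :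
    psi x t = maxWeight (maxChains Set.univ) x := by
  unfold psi
  rw [show Set.Iic t = Set.univ from Set.eq_univ_of_forall ht]

theorem copsi_le_maxWeight {p : P} (hp : IsMin p) (x : P → ℝ) :
    copsi x p ≤ maxWeight (maxChains Set.univ) x := by
  have h := maxWeight_maxChainsThrough p x
  rw [psi_of_isMin hp, add_sub_cancel_left] at h
  rw [← h]
  exact maxWeight_le (maxChainsThrough_nonempty p) fun C hC => le_maxWeight hC.1 x

theorem exists_copsi_eq_maxWeight [Nonempty P] (x : P → ℝ) :
    ∃ p : P, IsMin p ∧ copsi x p = maxWeight (maxChains Set.univ) x := by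
  obtain ⟨C, hC, h⟩ := exists_maxWeight_eq (maxChains_nonempty (Set.univ : Set P)) x
  have hC' := mem_maxChains.1 hC
  have hne : C.Nonempty := by
    by_contra hne
    rw [Finset.not_nonempty_iff_eq_empty] at hne
    have := hC'.2 (Classical.arbitrary P) trivial (by simp [hne])
    simp [hne] at this
  obtain ⟨p, hp, hmin⟩ := C.exists_minimal hne
  have hpmin : IsMin p := fun q hq => by
    have hqC : q ∈ C := hC'.2 q trivial fun z hz => by
      rcases hC'.1.2 p hp z hz with h | h
      · exact Or.inr (le_trans hq h)
      · exact Or.inr (le_trans hq (hmin hz h))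
    exact hmin hqC hq
  refine ⟨p, hpmin, le_antisymm (copsi_le_maxWeight hpmin x) ?_⟩
  have h1 := maxWeight_maxChainsThrough p x
  rw [psi_of_isMin hpmin, add_sub_cancel_left] at h1
  rw [← h1, h]
  have hCp : C ∈ maxChainsThrough p := ⟨hC, hp⟩
  exact le_maxWeight hCp x

theorem copsi_of_isBot {b : P} (hb : IsBot b) (x : P → ℝ) :
    copsi x b = maxWeight (maxChains Set.univ) x := by
  unfold copsi
  rw [show Set.Ici b = Set.univ from Set.eq_univ_of_forall hb]

theorem copsi_update_of_isTop [DecidableEq P] {t : P} (ht : IsTop t) (x : P → ℝ) (v : ℝ) (p : P) :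
    copsi (Function.update x t v) p = copsi x p + (v - x t) :=
  maxWeight_update_of_forall_mem (maxChains_nonempty _) (fun _ hC =>
    (mem_maxChains.1 hC).2 t (ht p) fun q _ => Or.inl (ht q)) x v

end Weights

/-! ### The transfer map, and plane partitions as images of natural labelings. -/

section Transfer

variable {P : Type*} [PartialOrder P] [Fintype P]

theorem transferMap_eq_of_forall {x d : P → ℝ} (hmin : ∀ p, IsMin p → d p = x p)
    (hle : ∀ p q, q ⋖ p → x p + d q ≤ d p)
    (hex : ∀ p, ¬ IsMin p → ∃ q, q ⋖ p ∧ d p = x p + d q) : transferMap d = x := by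
  funext p
  unfold transferMap
  split_ifs with hp
  · rw [hmin p hp, sub_zero]
  · obtain ⟨q, hq, h⟩ := hex p hp
    have : (⨆ q : {q : P // q ⋖ p}, d q) = d q := by
      have : Nonempty {q : P // q ⋖ p} := ⟨⟨q, hq⟩⟩
      apply le_antisymm
      · exact ciSup_le fun z => by linarith [hle p z z.2]
      · exact le_ciSup (f := fun q : {q : P // q ⋖ p} => d q) (Set.finite_range _).bddAbove ⟨q, hq⟩
    rw [this, h]
    ring

theorem transferMap_psi (x : P → ℝ) : transferMap (psi x) = x :=
  transferMap_eq_of_forall (fun _ hp => psi_of_isMin hp x) (fun _ _ h => add_psi_le h x)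
    fun _ hp => exists_psi_eq hp x

theorem psi_injective : Function.Injective (psi : (P → ℝ) → P → ℝ) :=
  Function.LeftInverse.injective transferMap_psi

theorem transferMap_injective : Function.Injective (transferMap : (P → ℝ) → P → ℝ) := by
  intro x y hxy
  funext p
  induction p using WellFoundedLT.induction with
  | ind p ih =>
    have h := congrFun hxy p
    unfold transferMap at h
    split_ifs at h with hp
    · simpa using h
    · have : (⨆ q : {q : P // q ⋖ p}, x q) = ⨆ q : {q : P // q ⋖ p}, y q := by
        congr 1
        funext q
        exact ih q q.2.lt
      rw [this] at h
      linarith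

theorem psi_transferMap (x : P → ℝ) : psi (transferMap x) = x :=
  transferMap_injective (transferMap_psi _)

theorem monotone_psi {x : P → ℝ} (hx : ∀ p, 0 ≤ x p) : Monotone (psi x) := by
  intro q p hqp
  induction p using WellFoundedLT.induction with
  | ind p ih =>
    rcases hqp.eq_or_lt with rfl | hlt
    · exact le_rfl
    · obtain ⟨z, hqz, hz⟩ := exists_le_covBy_of_lt hlt
      exact (ih z hz.lt hqz).trans (by linarith [add_psi_le hz x, hx p])

/-- The labelings by nonnegative integers. -/
def IsNatLabeling {Q : Type*} (x : Q → ℝ) : Prop := ∀ p, ∃ n : ℕ, x p = n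

theorem IsNatLabeling.exists_toReal {Q : Type*} {x : Q → ℝ} (hx : IsNatLabeling x) :
    ∃ n : Q → ℕ, x = toReal n := by
  choose n hn using hx
  exact ⟨n, funext hn⟩

theorem isNatLabeling_psi {x : P → ℝ} (hx : IsNatLabeling x) : IsNatLabeling (psi x) := by
  intro p
  induction p using WellFoundedLT.induction with
  | ind p ih =>
    obtain ⟨n, hn⟩ := hx p
    by_cases hp : IsMin p
    · exact ⟨n, by rw [psi_of_isMin hp, hn]⟩
    · obtain ⟨q, hq, h⟩ := exists_psi_eq hp x
      obtain ⟨m, hm⟩ := ih q hq.lt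
      exact ⟨n + m, by rw [h, hn, hm]; push_cast; rfl⟩

theorem isNatLabeling_transferMap {n : P → ℕ} (hn : Monotone n) :
    IsNatLabeling (transferMap (toReal n)) := by
  intro p
  by_cases hp : IsMin p
  · exact ⟨n p, by simp [transferMap, hp, toReal]⟩
  · obtain ⟨q, hq, h⟩ := exists_psi_eq hp (transferMap (toReal n))
    rw [psi_transferMap] at h
    refine ⟨n p - n q, ?_⟩
    rw [Nat.cast_sub (hn hq.le)]
    unfold toReal at h ⊢
    linarith

/-- `psi` maps the labelings by nonnegative integers with maximal chain weight `ℓ` to the plane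
partitions of height `ℓ`. -/
theorem psi_mem_planePartitions_iff {t : P} (ht : IsTop t) {x : P → ℝ} {ℓ : ℕ} :
    psi x ∈ toReal '' planePartitions P ℓ ↔ IsNatLabeling x ∧ psi x t = ℓ := by
  constructor
  · rintro ⟨n, ⟨hmono, ⟨p, hp⟩, hmax⟩, hx⟩
    have hxt : x = transferMap (toReal n) := by rw [hx, transferMap_psi]
    refine ⟨hxt ▸ isNatLabeling_transferMap hmono, ?_⟩
    rw [← hx]
    exact congrArg Nat.cast (le_antisymm (hmax ⟨t, rfl⟩) (hp ▸ hmono (ht p)))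
  · rintro ⟨hx, hxt⟩
    obtain ⟨n, hn⟩ := (isNatLabeling_psi hx).exists_toReal
    have hmono : Monotone n := fun p q hpq => by
      have := monotone_psi (x := x) (fun p => by obtain ⟨m, hm⟩ := hx p; rw [hm]; positivity) hpq
      rw [hn] at this
      exact Nat.cast_le.1 this
    have hnt : n t = ℓ := by
      rw [hn] at hxt
      exact Nat.cast_injective hxt
    refine ⟨n, ⟨hmono, ⟨t, hnt⟩, ?_⟩, hn.symm⟩
    rintro _ ⟨p, rfl⟩
    exact hnt ▸ hmono (ht p)

end Transfer

/-! ### The identity that characterizes antichain rowmotion. -/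

section Rowmotion

theorem ofFn_reverse_prod_apply {α : Type*} {n : ℕ} (f : Fin n → Equiv.Perm α) (z : ℕ → α)
    (hz : ∀ i : Fin n, z (i + 1) = f i (z i)) : (List.ofFn f).reverse.prod (z 0) = z n := by
  induction n with
  | zero => simp
  | succ n ih =>
    rw [List.ofFn_succ_last, List.reverse_append, List.prod_append, Equiv.Perm.mul_apply,
      ih (fun i => f i.castSucc) fun i => hz i.castSucc]
    simpa using (hz (Fin.last n)).symm

variable {P : Type*} [PartialOrder P] [Fintype P] [DecidableEq P]

/-- When `p` is toggled, all labels below it are already final and all labels from `p` upwards are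
still those of `y`. The toggled value is therefore minus the final `psi - label` at `p`, minus
`copsi y p`. -/
theorem psi_rowmotion_add_copsi (L : LinExt P) (y : P → ℝ) (p : P) :
    psi (rowmotion L y) p + copsi y p = 0 := by
  let n := Fintype.card P
  -- `z m` is the labeling after the first `m` toggles.
  let z : ℕ → P → ℝ := fun m => Nat.rec y
    (fun i w => if h : i < n then toggle (L.1.symm ⟨i, h⟩) w else w) m
  have hz : ∀ i : Fin n, z (i + 1) = toggle (L.1.symm i) (z i) := fun i => by
    show (if h : (i : ℕ) < n then toggle (L.1.symm ⟨i, h⟩) (z i) else z i) = _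
    rw [dif_pos i.2]
  have hrow : rowmotion L y = z n := ofFn_reverse_prod_apply _ z hz
  have hstep : ∀ (i : ℕ) (q : P), (L.1 q : ℕ) ≠ i → z (i + 1) q = z i q := by
    intro i q hq
    by_cases h : i < n
    · rw [show z (i + 1) = toggle (L.1.symm ⟨i, h⟩) (z i) from hz ⟨i, h⟩]
      refine Function.update_of_ne ?_ _ _
      rintro rfl
      simp at hq
    · show (if h : i < n then toggle (L.1.symm ⟨i, h⟩) (z i) else z i) q = _
      rw [dif_neg h]
  have hlow : ∀ (q : P) (m : ℕ), m ≤ L.1 q → z m q = y q := by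
    intro q m hm
    induction m with
    | zero => rfl
    | succ m ih => rw [hstep m q (by omega), ih (by omega)]
  have hhigh : ∀ (q : P) (m : ℕ), (L.1 q : ℕ) < m → z m q = z (L.1 q + 1) q := by
    intro q m hm
    induction m with
    | zero => omega
    | succ m ih =>
      rcases Nat.lt_succ_iff_lt_or_eq.1 hm with h | h
      · rw [hstep m q (by omega), ih h]
      · rw [h]
  have hfin : ∀ (q : P) (m : ℕ), (L.1 q : ℕ) < m → z m q = rowmotion L y q := by
    intro q m hm
    rw [hrow, hhigh q m hm, hhigh q n (L.1 q).2]
  have hp : rowmotion L y p = -maxWeight (maxChainsThrough p) (z (L.1 p)) := by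
    rw [← hfin p (L.1 p + 1) (by omega), hz (L.1 p), Equiv.symm_apply_apply]
    exact Function.update_self _ _ _
  have h1 : copsi (z (L.1 p)) p = copsi y p := copsi_congr fun q hq => hlow q _ (L.2 hq)
  have h2 := psi_sub_congr (p := p) (x := z (L.1 p)) (y := rowmotion L y) fun q hq =>
    hfin q _ (lt_of_le_of_ne (L.2 hq.le) fun h => hq.ne (L.1.injective (Fin.ext h)))
  rw [maxWeight_maxChainsThrough, h1] at hp
  linarith

theorem psi_add_copsi_rowmotion_symm (L : LinExt P) (x : P → ℝ) (p : P) :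
    psi x p + copsi ((rowmotion L).symm x) p = 0 := by
  simpa using psi_rowmotion_add_copsi L ((rowmotion L).symm x) p

end Rowmotion

/-! ### Integrality and nonnegativity under rowmotion. -/

section Integrality

variable {P : Type*} [PartialOrder P] [Fintype P]

/-- The bottom label may be any real number, but it occurs once in every chain from the bottom. -/
theorem exists_int_psi_sub {b : P} (hb : IsBot b) {x : P → ℝ}
    (hx : ∀ p ≠ b, ∃ n : ℕ, x p = n) (p : P) : ∃ m : ℤ, psi x p - x b = m := by
  induction p using WellFoundedLT.induction with
  | ind p ih =>
    by_cases hp : IsMin p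
    · refine ⟨0, ?_⟩
      rw [psi_of_isMin hp, hp.eq_of_le (hb p)]
      simp
    · obtain ⟨q, hq, h⟩ := exists_psi_eq hp x
      obtain ⟨m, hm⟩ := ih q hq.lt
      obtain ⟨n, hn⟩ := hx p fun h => hp (h ▸ hb.isMin)
      refine ⟨n + m, ?_⟩
      push_cast
      linarith

/-- For a cover `q` of `p` attaining `copsi y p`, the relation gives `y p = psi x q - psi x p`. This
is an integer, and it is at least `x q ≥ 0`. -/
theorem exists_nat_of_psi_add_copsi {b : P} (hb : IsBot b) {x y : P → ℝ}
    (h : ∀ p, psi x p + copsi y p = 0) (hx : ∀ p ≠ b, ∃ n : ℕ, x p = n) {p : P}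
    (hp : ¬ IsMax p) : ∃ n : ℕ, y p = n := by
  obtain ⟨q, hq, hyp⟩ := exists_copsi_eq hp y
  obtain ⟨m, hm⟩ := exists_int_psi_sub hb hx p
  obtain ⟨m', hm'⟩ := exists_int_psi_sub hb hx q
  have hqb : q ≠ b := fun h => hq.lt.not_ge (h ▸ hb p)
  obtain ⟨n, hn⟩ := hx q hqb
  have h1 : y p = ((m' - m : ℤ) : ℝ) := by
    push_cast
    linarith [h p, h q]
  have h2 : (0 : ℝ) ≤ y p := by
    have : (0 : ℝ) ≤ x q := hn ▸ Nat.cast_nonneg n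
    linarith [h p, h q, add_psi_le hq x]
  rw [h1] at h2 ⊢
  obtain ⟨k, hk⟩ := Int.eq_ofNat_of_zero_le (Int.cast_nonneg_iff.1 h2)
  exact ⟨k, by rw [hk]; simp⟩

theorem exists_nat_of_copsi_add_psi {t : P} (ht : IsTop t) {x y : P → ℝ}
    (h : ∀ p, psi x p + copsi y p = 0) (hy : ∀ p ≠ t, ∃ n : ℕ, y p = n) {p : P}
    (hp : ¬ IsMin p) : ∃ n : ℕ, x p = n := by
  refine exists_nat_of_psi_add_copsi (P := Pᵒᵈ) (b := t) (x := y) (y := x) ht (fun p => ?_) hy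
    (p := p) hp
  have h1 : psi (P := Pᵒᵈ) y p = copsi (P := P) y p := (copsi_eq_psi_orderDual (P := P) y p).symm
  have h2 : copsi (P := Pᵒᵈ) x p = psi (P := P) x p := copsi_eq_psi_orderDual (P := Pᵒᵈ) x p
  rw [h1, h2, add_comm]
  exact h p

end Integrality

/-! ### Calculus of piecewise-linear maps. -/

section PiecewiseLinear

variable {E F G : Type*} [AddCommGroup E] [Module ℝ E] [AddCommGroup F] [Module ℝ F]
  [AddCommGroup G] [Module ℝ G]

theorem isPolyhedron_univ : IsPolyhedron (Set.univ : Set E) := ⟨∅, by simp⟩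

theorem IsPolyhedron.inter {S T : Set E} (hS : IsPolyhedron S) (hT : IsPolyhedron T) :
    IsPolyhedron (S ∩ T) := by
  classical
  obtain ⟨H, rfl⟩ := hS
  obtain ⟨K, rfl⟩ := hT
  refine ⟨H ∪ K, ?_⟩
  ext x
  simp only [Set.mem_inter_iff, Set.mem_ofPred_eq, Finset.mem_union]
  exact ⟨fun h k hk => hk.elim (h.1 k) (h.2 k), fun h => ⟨fun k hk => h k (Or.inl hk),
    fun k hk => h k (Or.inr hk)⟩⟩

theorem isPolyhedron_iInter {ι : Type*} [Finite ι] {S : ι → Set E} (hS : ∀ i, IsPolyhedron (S i)) :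
    IsPolyhedron (⋂ i, S i) := by
  classical
  have := Fintype.ofFinite ι
  choose H hH using hS
  refine ⟨Finset.univ.biUnion H, ?_⟩
  ext x
  simp only [hH, Set.mem_iInter, Set.mem_ofPred_eq, Finset.mem_biUnion, Finset.mem_univ, true_and]
  exact ⟨fun h k ⟨i, hk⟩ => h i k hk, fun h i k hk => h k ⟨i, hk⟩⟩

theorem IsPolyhedron.preimage {S : Set F} (hS : IsPolyhedron S) (g : E →ᵃ[ℝ] F) :
    IsPolyhedron (g ⁻¹' S) := by
  classical
  obtain ⟨H, rfl⟩ := hS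
  refine ⟨H.image fun h => (h.1 ∘ₗ g.linear, h.2 - h.1 (g 0)), ?_⟩
  ext x
  have hg : g x = g.linear x + g 0 := by
    conv_lhs => rw [AffineMap.decomp g]
    simp
  simp only [Set.mem_preimage, Set.mem_ofPred_eq, Finset.mem_image, forall_exists_index, and_imp,
    forall_apply_eq_imp_iff₂, LinearMap.comp_apply, hg, map_add, le_sub_iff_add_le]

theorem isPiecewiseLinear_affine (g : E →ᵃ[ℝ] F) : IsPiecewiseLinear g :=
  ⟨{Set.univ}, Set.finite_singleton _, by simpa using isPolyhedron_univ, by simp,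
    fun S _ => ⟨g, fun x _ => rfl⟩⟩

theorem isPiecewiseLinear_linear (g : E →ₗ[ℝ] F) : IsPiecewiseLinear g :=
  isPiecewiseLinear_affine g.toAffineMap

theorem isPiecewiseLinear_id : IsPiecewiseLinear (fun x : E => x) :=
  isPiecewiseLinear_linear LinearMap.id

theorem isPiecewiseLinear_const (c : F) : IsPiecewiseLinear (fun _ : E => c) :=
  isPiecewiseLinear_affine (AffineMap.const ℝ E c)

/-- Each cell of `f` is subdivided by the preimages of the cells of `g` under the affine map that
represents `f` there. -/
theorem IsPiecewiseLinear.comp {g : F → G} {f : E → F} (hg : IsPiecewiseLinear g)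
    (hf : IsPiecewiseLinear f) : IsPiecewiseLinear (g ∘ f) := by
  obtain ⟨𝒮, h𝒮, hpS, hcS, hS⟩ := hf
  obtain ⟨𝒯, h𝒯, hpT, hcT, hT⟩ := hg
  choose! a ha using hS
  choose! b hb using hT
  refine ⟨Set.image2 (fun S T => S ∩ a S ⁻¹' T) 𝒮 𝒯, h𝒮.image2 _ h𝒯, ?_, ?_, ?_⟩
  · rintro _ ⟨S, hS, T, hT, rfl⟩
    exact (hpS S hS).inter ((hpT T hT).preimage _)
  · refine Set.eq_univ_of_forall fun x => ?_
    obtain ⟨S, hS, hxS⟩ := Set.mem_sUnion.1 (hcS.symm ▸ Set.mem_univ x)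
    obtain ⟨T, hT, hxT⟩ := Set.mem_sUnion.1 (hcT.symm ▸ Set.mem_univ (f x))
    exact ⟨_, ⟨S, hS, T, hT, rfl⟩, hxS, by rwa [Set.mem_preimage, ← ha S hS hxS]⟩
  · rintro _ ⟨S, hS, T, hT, rfl⟩
    refine ⟨(b T).comp (a S), fun x hx => ?_⟩
    rw [Function.comp_apply, ha S hS hx.1, hb T hT hx.2, AffineMap.comp_apply]

theorem isPiecewiseLinear_pi {ι : Type*} [Finite ι] {f : E → ι → ℝ}
    (hf : ∀ i, IsPiecewiseLinear fun x => f x i) : IsPiecewiseLinear f := by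
  choose 𝒮 h𝒮 hp hc hS using hf
  choose! a ha using hS
  refine ⟨(fun S : ι → Set E => ⋂ i, S i) '' Set.univ.pi 𝒮, (Set.Finite.pi' h𝒮).subset ?_ |>.image _,
    ?_, ?_, ?_⟩
  · exact fun S hS i => hS i trivial
  · rintro _ ⟨S, hS, rfl⟩
    exact isPolyhedron_iInter fun i => hp i _ (hS i trivial)
  · refine Set.eq_univ_of_forall fun x => ?_
    have : ∀ i, ∃ S ∈ 𝒮 i, x ∈ S := fun i => Set.mem_sUnion.1 ((hc i).symm ▸ Set.mem_univ x)
    choose S hS hx using this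
    exact ⟨_, ⟨S, fun i _ => hS i, rfl⟩, Set.mem_iInter.2 hx⟩
  · rintro _ ⟨S, hS, rfl⟩
    refine ⟨AffineMap.pi fun i => a i (S i), fun x hx => funext fun i => ?_⟩
    exact ha i (S i) (hS i trivial) (Set.mem_iInter.1 hx i)

theorem isPiecewiseLinear_proj {ι : Type*} (i : ι) : IsPiecewiseLinear fun x : ι → ℝ => x i :=
  isPiecewiseLinear_linear (LinearMap.proj i : (ι → ℝ) →ₗ[ℝ] ℝ)

theorem isPiecewiseLinear_sub {f g : E → ℝ} (hf : IsPiecewiseLinear f)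
    (hg : IsPiecewiseLinear g) : IsPiecewiseLinear fun x => f x - g x := by
  have h : IsPiecewiseLinear fun x => ![f x, g x] := isPiecewiseLinear_pi fun i => by
    fin_cases i
    exacts [hf, hg]
  exact (isPiecewiseLinear_linear ((LinearMap.proj 0 : (Fin 2 → ℝ) →ₗ[ℝ] ℝ) -
    LinearMap.proj 1)).comp h

/-- A maximum of finitely many linear functions is piecewise-linear. -/
theorem isPiecewiseLinear_iSup_linear {ι : Type*} [Finite ι] (f : ι → E →ₗ[ℝ] ℝ) :
    IsPiecewiseLinear fun x => ⨆ i, f i x := by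
  classical
  cases isEmpty_or_nonempty ι
  · simpa using isPiecewiseLinear_const (E := E) (0 : ℝ)
  have hbdd : ∀ x, BddAbove (Set.range fun i => f i x) := fun x => (Set.finite_range _).bddAbove
  refine ⟨Set.range fun i => {x | ∀ j, f j x ≤ f i x}, Set.finite_range _, ?_, ?_, ?_⟩
  · rintro _ ⟨i, rfl⟩
    have := Fintype.ofFinite ι
    refine ⟨Finset.univ.image fun j => (f j - f i, 0), ?_⟩
    ext x
    simp
  · refine Set.eq_univ_of_forall fun x => ?_
    obtain ⟨i, hi⟩ := exists_eq_ciSup_of_finite (f := fun i => f i x)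
    exact ⟨_, ⟨i, rfl⟩, fun j => hi ▸ le_ciSup (hbdd x) j⟩
  · rintro _ ⟨i, rfl⟩
    exact ⟨(f i).toAffineMap, fun x hx => le_antisymm (ciSup_le hx) (le_ciSup (hbdd x) i)⟩

/-- A map is continuous if it is so on each member of a finite closed cover. -/
theorem IsPiecewiseLinear.continuous {m n : Type*} [Finite m] [Finite n]
    {f : (m → ℝ) → n → ℝ} (hf : IsPiecewiseLinear f) : Continuous f := by
  have := Fintype.ofFinite m
  have := Fintype.ofFinite n
  obtain ⟨𝒮, h𝒮, hp, hc, hS⟩ := hf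
  have := h𝒮.to_subtype
  refine (locallyFinite_of_finite fun S : 𝒮 => S.1).continuous ?_ ?_ ?_
  · rw [← Set.sUnion_eq_iUnion, hc]
  · rintro ⟨S, hS⟩
    obtain ⟨H, rfl⟩ := hp S hS
    have : {x : m → ℝ | ∀ h ∈ H, h.1 x ≤ h.2} = ⋂ h ∈ H, {x | h.1 x ≤ h.2} := by
      ext x
      simp
    show IsClosed {x : m → ℝ | ∀ h ∈ H, h.1 x ≤ h.2}
    rw [this]
    exact isClosed_biInter fun h _ =>
      isClosed_le (LinearMap.continuous_of_finiteDimensional h.1) continuous_const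
  · rintro ⟨S, hS'⟩
    obtain ⟨g, hg⟩ := hS S hS'
    have hgc : Continuous g := AffineMap.continuous_of_finiteDimensional g
    exact hgc.continuousOn.congr hg

end PiecewiseLinear

/-! ### Piecewise-linearity of `psi`, the transfer map and rowmotion. -/

section Maps

variable {P : Type*} [PartialOrder P] [Fintype P]

theorem isPiecewiseLinear_maxWeight (𝒞 : Set (Finset P)) : IsPiecewiseLinear (maxWeight 𝒞) := by
  have h := isPiecewiseLinear_iSup_linear fun C : 𝒞 =>
    (∑ q ∈ C.1, LinearMap.proj q : (P → ℝ) →ₗ[ℝ] ℝ)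
  convert h using 2 with x
  simp [maxWeight, LinearMap.sum_apply]

theorem isPiecewiseLinear_psi : IsPiecewiseLinear (psi : (P → ℝ) → P → ℝ) :=
  isPiecewiseLinear_pi fun p => isPiecewiseLinear_maxWeight (maxChains (Set.Iic p))

theorem isPiecewiseLinear_transferMap : IsPiecewiseLinear (transferMap : (P → ℝ) → P → ℝ) := by
  refine isPiecewiseLinear_pi fun p => isPiecewiseLinear_sub (isPiecewiseLinear_proj p) ?_
  split_ifs
  · exact isPiecewiseLinear_const 0
  · exact isPiecewiseLinear_iSup_linear fun q : {q : P // q ⋖ p} =>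
      (LinearMap.proj q.1 : (P → ℝ) →ₗ[ℝ] ℝ)

variable [DecidableEq P]

theorem isPiecewiseLinear_toggleFun (p : P) : IsPiecewiseLinear (toggleFun p) := by
  refine isPiecewiseLinear_pi fun q => ?_
  by_cases h : q = p
  · subst h
    simpa [toggleFun] using isPiecewiseLinear_sub (isPiecewiseLinear_const 0)
      (isPiecewiseLinear_maxWeight (maxChainsThrough q))
  · simpa [toggleFun, h] using isPiecewiseLinear_proj q

theorem isPiecewiseLinear_prod_inv {l : List (Equiv.Perm (P → ℝ))}
    (hl : ∀ e ∈ l, IsPiecewiseLinear e.symm) : IsPiecewiseLinear l.prod.symm := by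
  induction l with
  | nil => exact isPiecewiseLinear_id
  | cons e l ih =>
    rw [List.prod_cons]
    exact (ih fun e' he' => hl e' (List.mem_cons_of_mem _ he')).comp (hl e List.mem_cons_self)

theorem isPiecewiseLinear_rowmotion_symm (L : LinExt P) :
    IsPiecewiseLinear (rowmotion L).symm := by
  refine isPiecewiseLinear_prod_inv fun e he => ?_
  simp only [List.mem_reverse, List.mem_ofFn] at he
  obtain ⟨i, rfl⟩ := he
  exact isPiecewiseLinear_toggleFun _

end Maps

/-! ### Piecewise-linearity of `zeta`. -/

section Zeta

variable {r s : ℕ}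

theorem isPiecewiseLinear_label {S : Finset (ℕ × ℕ)} (p : ℕ × ℕ) :
    IsPiecewiseLinear fun x : S → ℝ => label x p := by
  by_cases h : p ∈ S
  · simpa [label, h] using isPiecewiseLinear_proj (⟨p, h⟩ : S)
  · simpa [label, h] using isPiecewiseLinear_const (0 : ℝ)

theorem isPiecewiseLinear_bar {k : ℕ} (a : ℝ) :
    IsPiecewiseLinear (bar a : (inter r s (k + 1) → ℝ) → mid r s k → ℝ) := by
  refine isPiecewiseLinear_pi fun p => ?_
  unfold bar
  split_ifs
  · exact isPiecewiseLinear_const a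
  · exact isPiecewiseLinear_label p.1

theorem isPiecewiseLinear_zetaStep (k : ℕ) (L : LinExt (mid r s k)) (a : ℝ) :
    IsPiecewiseLinear (zetaStep k L a) := by
  refine isPiecewiseLinear_pi fun p => ?_
  unfold zetaStep
  split_ifs with h
  · exact (isPiecewiseLinear_proj (⟨p.1, h⟩ : mid r s k)).comp
      ((isPiecewiseLinear_rowmotion_symm L).comp (isPiecewiseLinear_bar a))
  · exact isPiecewiseLinear_label _
  · exact isPiecewiseLinear_label _

theorem isPiecewiseLinear_zetaComp (L : ∀ k, LinExt (mid r s k)) (a : ℕ → ℝ) (n : ℕ) :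
    IsPiecewiseLinear (zetaComp L a n) := by
  induction n with
  | zero => exact isPiecewiseLinear_id
  | succ n ih => exact ih.comp (isPiecewiseLinear_zetaStep (n + 1) _ _)

theorem isPiecewiseLinear_zeta (L : ∀ k, LinExt (mid r s k)) (a : ℕ → ℝ) :
    IsPiecewiseLinear (zeta L a) := by
  refine isPiecewiseLinear_pi fun p => (isPiecewiseLinear_label p.1).comp
    ((isPiecewiseLinear_zetaComp L a (s - 1)).comp ?_)
  exact isPiecewiseLinear_pi fun q => isPiecewiseLinear_label q.1

theorem isPiecewiseLinear_psi_zeta_transferMap (L : ∀ k, LinExt (mid r s k)) (a : ℕ → ℝ) :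
    IsPiecewiseLinear (psi ∘ zeta L a ∘ transferMap : (trap r s → ℝ) → rect r s → ℝ) :=
  isPiecewiseLinear_psi.comp ((isPiecewiseLinear_zeta L a).comp isPiecewiseLinear_transferMap)

end Zeta

/-! ### Lattice path sums over a commutative semiring and their invariance. -/

section PathSums

variable {K : Type*} [CommSemiring K]

/-- The solution of the recursion `u i j = F i j (u (i + 1) j) (u i (j + 1))` for `i ≤ N`, `j ≤ s`
with boundary values `b` in row `s + 1` and zeros elsewhere. -/
def backward (N s : ℕ) (b : ℕ → K) (F : ℕ → ℕ → K → K → K) (i j : ℕ) : K :=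
  if j = s + 1 then b i
  else if i ≤ N ∧ j ≤ s then F i j (backward N s b F (i + 1) j) (backward N s b F i (j + 1))
  else 0
termination_by (N + 1 - i) + (s + 1 - j)

/-- `X i j` is the sum of the weights of the lattice paths that start in `(i, j)` and leave row `s`
upwards in column `e`; `Xn` and `Xt` count only the paths that avoid, respectively meet, the
diagonal `i + 1 = r + j` in a row up to `s`. -/
structure PathSums (r s e : ℕ) (f X Xn Xt : ℕ → ℕ → K) : Prop where
  top : ∀ i, X i (s + 1) = if i = e then 1 else 0
  topn : ∀ i, Xn i (s + 1) = if i = e then 1 else 0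
  topt : ∀ i, Xt i (s + 1) = 0
  step : ∀ i j, j ≤ s → X i j = f i j * (X (i + 1) j + X i (j + 1))
  stepn : ∀ i j, j ≤ s → i + 1 ≠ r + j → Xn i j = f i j * (Xn (i + 1) j + Xn i (j + 1))
  diagn : ∀ i j, j ≤ s → i + 1 = r + j → Xn i j = 0
  stept : ∀ i j, j ≤ s → i + 1 ≠ r + j → Xt i j = f i j * (Xt (i + 1) j + Xt i (j + 1))
  diagt : ∀ i j, j ≤ s → i + 1 = r + j → Xt i j = X i j

theorem backward_top (N s : ℕ) (b : ℕ → K) (F : ℕ → ℕ → K → K → K) (i : ℕ) :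
    backward N s b F i (s + 1) = b i := by
  rw [backward, if_pos rfl]

theorem backward_step (N s : ℕ) (b : ℕ → K) (F : ℕ → ℕ → K → K → K) (i j : ℕ) (hj : j ≤ s)
    (hF : N < i → ∀ u v, F i j u v = 0) : backward N s b F i j =
      F i j (backward N s b F (i + 1) j) (backward N s b F i (j + 1)) := by
  by_cases h : i ≤ N
  · rw [backward, if_neg (by omega), if_pos ⟨h, hj⟩]
  · rw [backward, if_neg (by omega), if_neg (by omega), hF (by omega)]

theorem exists_pathSums (r s e : ℕ) {N : ℕ} {f : ℕ → ℕ → K} (hf : ∀ i j, N < i → f i j = 0) :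
    ∃ X Xn Xt, PathSums r s e f X Xn Xt := by
  let X := backward N s (fun i => if i = e then 1 else 0) fun i j u v => f i j * (u + v)
  have hX : ∀ i j, j ≤ s → X i j = f i j * (X (i + 1) j + X i (j + 1)) := fun i j hj =>
    backward_step _ _ _ _ i j hj fun h u v => by rw [hf i j h, zero_mul]
  let Fn : ℕ → ℕ → K → K → K := fun i j u v => if i + 1 = r + j then 0 else f i j * (u + v)
  let Xn := backward N s (fun i => if i = e then 1 else 0) Fn
  have hXn : ∀ i j, j ≤ s → Xn i j = Fn i j (Xn (i + 1) j) (Xn i (j + 1)) := fun i j hj =>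
    backward_step _ _ _ _ i j hj fun h u v => by simp [Fn, hf i j h]
  -- Once the diagonal is reached, the continuation is unrestricted, so the recursion passes to `X`.
  let Ft : ℕ → ℕ → K → K → K := fun i j u v =>
    if i + 1 = r + j then f i j * (X (i + 1) j + X i (j + 1)) else f i j * (u + v)
  let Xt := backward N s (fun _ => 0) Ft
  have hXt : ∀ i j, j ≤ s → Xt i j = Ft i j (Xt (i + 1) j) (Xt i (j + 1)) := fun i j hj =>
    backward_step _ _ _ _ i j hj fun h u v => by simp [Ft, hf i j h]
  refine ⟨X, Xn, Xt, backward_top _ _ _ _, backward_top _ _ _ _, backward_top _ _ _ _, hX,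
    fun i j hj h => ?_, fun i j hj h => ?_, fun i j hj h => ?_, fun i j hj h => ?_⟩
  · rw [hXn i j hj]
    exact if_neg h
  · rw [hXn i j hj]
    exact if_pos h
  · rw [hXt i j hj]
    exact if_neg h
  · rw [hXt i j hj, hX i j hj]
    exact if_pos h

/-- Induction from the upper right corner of a grid towards the lower left one. -/
theorem descending_induction {N s : ℕ} {p : ℕ → ℕ → Prop} (hN : ∀ i j, j ≤ s → N < i → p i j)
    (top : ∀ i, p i (s + 1))
    (step : ∀ i j, i ≤ N → j ≤ s → p (i + 1) j → p i (j + 1) → p i j) (i j : ℕ)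
    (hj : j ≤ s + 1) : p i j := by
  rcases hj.eq_or_lt with h | h
  · exact h ▸ top i
  · by_cases hi : N < i
    · exact hN i j (by omega) hi
    · exact step i j (by omega) (by omega)
        (descending_induction hN top step (i + 1) j (by omega))
        (descending_induction hN top step i (j + 1) (by omega))
termination_by (N + 1 - i) + (s + 1 - j)

variable {r s k e N : ℕ} {f g X Xn Xt Y Yn Yt : ℕ → ℕ → K}

theorem PathSums.eq_zero_of_eq_zero (hX : PathSums r s e f X Xn Xt) {i j : ℕ} (hj : j ≤ s)
    (hf : f i j = 0) : X i j = 0 := by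
  rw [hX.step i j hj, hf, zero_mul]

theorem PathSums.avoid_eq_zero_of_eq_zero (hX : PathSums r s e f X Xn Xt) {i j : ℕ} (hj : j ≤ s)
    (hf : f i j = 0) : Xn i j = 0 := by
  by_cases h : i + 1 = r + j
  · exact hX.diagn i j hj h
  · rw [hX.stepn i j hj h, hf, zero_mul]

theorem PathSums.meet_eq_zero_of_eq_zero (hX : PathSums r s e f X Xn Xt) {i j : ℕ} (hj : j ≤ s)
    (hf : f i j = 0) : Xt i j = 0 := by
  by_cases h : i + 1 = r + j
  · rw [hX.diagt i j hj h, hX.eq_zero_of_eq_zero hj hf]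
  · rw [hX.stept i j hj h, hf, zero_mul]

theorem PathSums.avoid_add_meet (hX : PathSums r s e f X Xn Xt) (hf : ∀ i j, N < i → f i j = 0)
    (i j : ℕ) (hj : j ≤ s + 1) : X i j = Xn i j + Xt i j := by
  refine descending_induction (N := N) (p := fun i j => X i j = Xn i j + Xt i j)
    (fun i j hj hi => ?_) (fun i => ?_) (fun i j _ hj h1 h2 => ?_) i j hj
  · have h := hf i j hi
    rw [hX.eq_zero_of_eq_zero hj h, hX.avoid_eq_zero_of_eq_zero hj h,
      hX.meet_eq_zero_of_eq_zero hj h, add_zero]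
  · rw [hX.top, hX.topn, hX.topt, add_zero]
  · by_cases h : i + 1 = r + j
    · rw [hX.diagn i j hj h, hX.diagt i j hj h, zero_add]
    · rw [hX.step i j hj, hX.stepn i j hj h, hX.stept i j hj h, h1, h2]
      ring

/-- Paths never descend, so from row `m` on they can meet the diagonal only in points of weight
zero. -/
theorem PathSums.meet_eq_zero (hX : PathSums r s e f X Xn Xt) (hf : ∀ i j, N < i → f i j = 0)
    {m : ℕ} (hm : ∀ i j, m ≤ j → i + 1 = r + j → f i j = 0) (i j : ℕ) (hj : j ≤ s + 1)
    (hmj : m ≤ j) : Xt i j = 0 := by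
  refine descending_induction (N := N) (p := fun i j => m ≤ j → Xt i j = 0)
    (fun i j hj hi _ => ?_) (fun i _ => hX.topt i) (fun i j _ hj h1 h2 hmj => ?_) i j hj hmj
  · exact hX.meet_eq_zero_of_eq_zero hj (hf i j hi)
  · by_cases h : i + 1 = r + j
    · rw [hX.diagt i j hj h, hX.eq_zero_of_eq_zero hj (hm i j hmj h)]
    · rw [hX.stept i j hj h, h1 hmj, h2 (by omega), add_zero, mul_zero]

/-- The total weight of the lattice paths that start in `(k, 1)`, or start in `(i, k + 1 - i)` with
`i < k` and meet the diagonal. -/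
def pathTotal (k : ℕ) (X Xt : ℕ → ℕ → K) : K := X k 1 + ∑ i ∈ Finset.Ico 1 k, Xt i (k + 1 - i)

/-- The points of the interval `mid r s k`. -/
def IsMid (r k i j : ℕ) : Prop := k ≤ i ∧ 1 ≤ j ∧ j ≤ k + 1 ∧ i + 1 ≤ r + j

/-- The relation between a labeling `f` of `inter r s (k + 1)` and its image `g` under `zetaStep`,
with labels in a commutative semiring and extended by zero. The function `D` sums the weights in `f`
of the paths from the minimum of the middle part, and its inverse `E` sums the weights in `g` of the
paths to the maximum of the middle part. -/
structure StepData (r s k : ℕ) (f g D E : ℕ → ℕ → K) : Prop where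
  one_le : 1 ≤ k
  lt : k < s
  le : s ≤ r
  fN : ∀ i j, r + s < i → f i j = 0
  gN : ∀ i j, r + s < i → g i j = 0
  D0 : ∀ i j, ¬ IsMid r k i j → D i j = 0
  E0 : ∀ i j, ¬ IsMid r k i j → E i j = 0
  DE : ∀ i j, IsMid r k i j → D i j * E i j = 1
  f0 : ∀ i j, k ≤ i → j ≤ k + 1 → ¬ IsMid r k i j → f i j = 0
  g0 : ∀ i j, k ≤ i → j ≤ k + 1 → ¬ IsMid r k i j → g i j = 0
  g_max : g (r + k) (k + 1) = 0
  f_diag : ∀ i j, k + 2 ≤ j → i + 1 = r + j → f i j = 0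
  g_diag : ∀ i j, k + 1 ≤ j → i + 1 = r + j → g i j = 0
  fD : ∀ i j, IsMid r k (i + 1) (j + 1) → ¬ (i + 1 = k ∧ j = 0) →
    f (i + 1) (j + 1) * (D i (j + 1) + D (i + 1) j) = D (i + 1) (j + 1)
  gE : ∀ i j, IsMid r k i j → ¬ (i = r + k ∧ j = k + 1) →
    g i j * (E (i + 1) j + E i (j + 1)) = E i j
  left : ∀ i j, i < k → 1 ≤ j → g i j = f i (j + 1)
  above : ∀ i j, k + 2 ≤ j → g i j = f (i + 1) j

variable {D E : ℕ → ℕ → K}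

/-- Conservation at the point `(i + 1, j + 1)`: the flow along an edge is `D` at its start times `X`
at its end. It fails only at the minimum `(k, 1)`, the source of the flow. -/
theorem StepData.flow (h : StepData r s k f g D E) (hX : PathSums r s (r + k) f X Xn Xt) (i j : ℕ)
    (hj : j ≤ k) (hmin : ¬ (i + 1 = k ∧ j = 0)) :
    (D i (j + 1) + D (i + 1) j) * X (i + 1) (j + 1) =
      D (i + 1) (j + 1) * (X (i + 2) (j + 1) + X (i + 1) (j + 2)) := by
  have hks := h.lt
  by_cases hm : IsMid r k (i + 1) (j + 1)
  · rw [hX.step (i + 1) (j + 1) (by omega), ← h.fD i j hm hmin]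
    ring
  · rw [h.D0 _ _ hm, zero_mul]
    by_cases hi : i + 1 < k
    · rw [h.D0 i (j + 1) (by unfold IsMid; omega), h.D0 (i + 1) j (by unfold IsMid; omega),
        add_zero, zero_mul]
    · rw [hX.eq_zero_of_eq_zero (by omega) (h.f0 _ _ (by omega) (by omega) hm), mul_zero]

/-- The same conservation for paths still to meet the diagonal; points of the diagonal are excluded
because `Xt` switches to `X` there. -/
theorem StepData.flow_meet (h : StepData r s k f g D E) (hX : PathSums r s (r + k) f X Xn Xt)
    (i j : ℕ) (hj : j ≤ k) (hmin : ¬ (i + 1 = k ∧ j = 0)) (hd : i + 1 ≠ r + j) :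
    (D i (j + 1) + D (i + 1) j) * Xt (i + 1) (j + 1) =
      D (i + 1) (j + 1) * (Xt (i + 2) (j + 1) + Xt (i + 1) (j + 2)) := by
  have hks := h.lt
  by_cases hm : IsMid r k (i + 1) (j + 1)
  · rw [hX.stept (i + 1) (j + 1) (by omega) (by omega), ← h.fD i j hm hmin]
    ring
  · rw [h.D0 _ _ hm, zero_mul]
    by_cases hi : i + 1 < k
    · rw [h.D0 i (j + 1) (by unfold IsMid; omega), h.D0 (i + 1) j (by unfold IsMid; omega),
        add_zero, zero_mul]
    · rw [hX.meet_eq_zero_of_eq_zero (by omega) (h.f0 _ _ (by omega) (by omega) hm), mul_zero]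

/-- The flow from row `j` to row `j + 1` in columns from `i + 1` to `m`. -/
def flowRight (m : ℕ) (D X : ℕ → ℕ → K) (i j : ℕ) : K :=
  ∑ i' ∈ Finset.Ico (i + 1) (m + 1), D i' j * X i' (j + 1)

/-- The flow from row `j` to row `j + 1` in columns up to `i`. -/
def flowLeft (D X : ℕ → ℕ → K) (i j : ℕ) : K := ∑ i' ∈ Finset.range (i + 1), D i' j * X i' (j + 1)

theorem flowRight_succ {m : ℕ} (i j : ℕ) (hi : i < m) :
    flowRight m D X i j = D (i + 1) j * X (i + 1) (j + 1) + flowRight m D X (i + 1) j :=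
  Finset.sum_eq_sum_Ico_succ_bot (by omega) _

theorem flowRight_of_le {m : ℕ} (i j : ℕ) (hi : m ≤ i) : flowRight m D X i j = 0 := by
  rw [flowRight, Finset.Ico_eq_empty (by omega), Finset.sum_empty]

theorem StepData.flowRight_eq_zero (h : StepData r s k f g D E) (i j : ℕ) (hi : r + j ≤ i + 1) :
    flowRight (r + k) D X i j = 0 :=
  Finset.sum_eq_zero fun i' hi' => by
    rw [Finset.mem_Ico] at hi'
    rw [h.D0 i' j (by unfold IsMid; omega), zero_mul]

theorem flowLeft_succ (i j : ℕ) :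
    flowLeft D X (i + 1) j = flowLeft D X i j + D (i + 1) j * X (i + 1) (j + 1) :=
  Finset.sum_range_succ _ _

/-- Conservation summed over the columns of row `j + 1` to the right of `i`: flow enters from below
and from the left, and leaves only upwards. -/
theorem StepData.flowRight_conserved (h : StepData r s k f g D E)
    (hX : PathSums r s (r + k) f X Xn Xt) (i j : ℕ) (hi : k ≤ i) (hj : j ≤ k) :
    flowRight (r + k) D X i (j + 1) =
      flowRight (r + k) D X i j + D i (j + 1) * X (i + 1) (j + 1) := by
  have hks := h.lt
  obtain ⟨d, hd⟩ : ∃ d, d = r + k - i := ⟨_, rfl⟩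
  induction d generalizing i with
  | zero =>
    rw [flowRight_of_le i _ (by omega), flowRight_of_le i _ (by omega),
      hX.eq_zero_of_eq_zero (i := i + 1) (by omega)
        (h.f0 _ _ (by omega) (by omega) (by unfold IsMid; omega)), mul_zero, add_zero]
  | succ d ih =>
    have hf := h.flow hX i j hj (by omega)
    rw [flowRight_succ i (j + 1) (by omega), ih (i + 1) (by omega) (by omega),
      flowRight_succ i j (by omega)]
    calc _ = D (i + 1) (j + 1) * (X (i + 2) (j + 1) + X (i + 1) (j + 2)) +
          flowRight (r + k) D X (i + 1) j := by ring
      _ = _ := by rw [← hf]; ring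

/-- Conservation summed over the columns of row `j + 1` up to `i`. The bounds on `i` and `j` keep
this segment off the diagonal and off the source. -/
theorem StepData.flowLeft_conserved (h : StepData r s k f g D E)
    (hX : PathSums r s (r + k) f X Xn Xt) (i j : ℕ) (hi : i < r + j) (hj1 : 1 ≤ j) (hj : j ≤ k) :
    flowLeft D Xt i j = flowLeft D Xt i (j + 1) + D i (j + 1) * Xt (i + 1) (j + 1) := by
  have hk := h.one_le
  induction i with
  | zero =>
    simp [flowLeft, h.D0 0 j (by unfold IsMid; omega), h.D0 0 (j + 1) (by unfold IsMid; omega)]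
  | succ i ih =>
    have hf := h.flow_meet hX i j hj (by omega) (by omega)
    rw [flowLeft_succ, ih (by omega), flowLeft_succ]
    calc _ = flowLeft D Xt i (j + 1) + (D i (j + 1) + D (i + 1) j) * Xt (i + 1) (j + 1) := by ring
      _ = _ := by rw [hf]; ring

theorem StepData.above_eq (h : StepData r s k f g D E) (hX : PathSums r s (r + k) f X Xn Xt)
    (hY : PathSums r s (r + k - 1) g Y Yn Yt) (i j : ℕ) (hj : j ≤ s + 1) (hkj : k + 2 ≤ j) :
    Y i j = X (i + 1) j := by
  have hk := h.one_le
  refine descending_induction (N := r + s) (p := fun i j => k + 2 ≤ j → Y i j = X (i + 1) j)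
    (fun i j hj hi _ => ?_) (fun i _ => ?_) (fun i j _ hj h1 h2 hkj => ?_) i j hj hkj
  · rw [hY.eq_zero_of_eq_zero hj (h.gN i j hi), hX.eq_zero_of_eq_zero hj (h.fN _ j (by omega))]
  · rw [hY.top, hX.top]
    exact if_congr (by omega) rfl rfl
  · rw [hY.step i j hj, hX.step (i + 1) j hj, h.above i j hkj, h1 hkj, h2 (by omega)]

/-- In these rows the labels and the exit column are shifted by one, and `g` vanishes on the
diagonal, so avoiding it is no restriction. -/
theorem StepData.avoid_above_eq (h : StepData r s k f g D E) (hX : PathSums r s (r + k) f X Xn Xt)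
    (hY : PathSums r s (r + k - 1) g Y Yn Yt) (i j : ℕ) (hj : j ≤ s + 1) (hkj : k + 2 ≤ j) :
    Yn i j = X (i + 1) j := by
  rw [← h.above_eq hX hY i j hj hkj, hY.avoid_add_meet h.gN i j hj,
    hY.meet_eq_zero h.gN h.g_diag i j hj (by omega), add_zero]

/-- By flow conservation, `E` times the flow to the right satisfies the recursion of `Yn`; `D * E =
1` at the two successors lets the horizontal flow term be exchanged for the vertical one. On the
diagonal both sides vanish, as no column of the middle part remains to the right. -/
theorem StepData.avoid_eq (h : StepData r s k f g D E) (hX : PathSums r s (r + k) f X Xn Xt)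
    (hY : PathSums r s (r + k - 1) g Y Yn Yt) (i j : ℕ) (hi : k ≤ i) (hj : j ≤ k + 1) :
    Yn i j = E i j * flowRight (r + k) D X i j := by
  have hks := h.lt
  refine descending_induction (N := r + k) (s := k)
    (p := fun i j => k ≤ i → Yn i j = E i j * flowRight (r + k) D X i j)
    ?_ ?_ ?_ i j hj hi
  · intro i j hj hi hki
    have hm : ¬ IsMid r k i j := by unfold IsMid; omega
    rw [hY.avoid_eq_zero_of_eq_zero (by omega) (h.g0 i j hki (by omega) hm), h.E0 i j hm, zero_mul]
  -- The top row of the middle part needs its own induction from the right: one step up leads to the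
  -- shifted sums of `avoid_above_eq`.
  · intro i hki
    obtain ⟨d, hd⟩ : ∃ d, d = r + k - i := ⟨_, rfl⟩
    induction d generalizing i with
    | zero =>
      have hg : g i (k + 1) = 0 := by
        by_cases hi : i = r + k
        · exact hi ▸ h.g_max
        · exact h.g0 i _ hki le_rfl (by unfold IsMid; omega)
      rw [hY.avoid_eq_zero_of_eq_zero (by omega) hg, flowRight_of_le _ _ (by omega), mul_zero]
    | succ d ih =>
      have hE := h.gE i (k + 1) (by unfold IsMid; omega) (by omega)
      have hDE := h.DE (i + 1) (k + 1) (by unfold IsMid; omega)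
      rw [h.E0 i (k + 1 + 1) (by unfold IsMid; omega), add_zero] at hE
      rw [hY.stepn i (k + 1) (by omega) (by omega), ih (i + 1) (by omega) (by omega),
        h.avoid_above_eq hX hY i (k + 1 + 1) (by omega) le_rfl, ← hE,
        flowRight_succ i (k + 1) (by omega)]
      calc _ = g i (k + 1) * (E (i + 1) (k + 1) * flowRight (r + k) D X (i + 1) (k + 1) +
            1 * X (i + 1) (k + 1 + 1)) := by rw [one_mul]
        _ = _ := by rw [← hDE]; ring
  · intro i j hir hj h1 h2 hki
    by_cases hm : IsMid r k i j
    · by_cases hd : i + 1 = r + j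
      · rw [hY.diagn i j (by omega) hd, h.flowRight_eq_zero i j (by omega), mul_zero]
      · unfold IsMid at hm
        have hE := h.gE i j hm (by omega)
        have hA := h.DE (i + 1) j (by unfold IsMid; omega)
        have hB := h.DE i (j + 1) (by unfold IsMid; omega)
        rw [hY.stepn i j (by omega) hd, h1 (by omega), h2 hki,
          h.flowRight_conserved hX i j hki hj, ← hE, flowRight_succ i j (by omega)]
        calc _ = g i j * (E (i + 1) j * flowRight (r + k) D X (i + 1) j +
              E i (j + 1) * (D (i + 1) j * X (i + 1) (j + 1) + flowRight (r + k) D X (i + 1) j) +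
              (D i (j + 1) * E i (j + 1)) * X (i + 1) (j + 1)) := by
                ring
          _ = g i j * (E (i + 1) j * flowRight (r + k) D X (i + 1) j +
              E i (j + 1) * (D (i + 1) j * X (i + 1) (j + 1) + flowRight (r + k) D X (i + 1) j) +
              (D (i + 1) j * E (i + 1) j) * X (i + 1) (j + 1)) := by rw [hA, hB]
          _ = _ := by ring
    · rw [hY.avoid_eq_zero_of_eq_zero (by omega) (h.g0 i j hki (by omega) hm), h.E0 i j hm,
        zero_mul]

/-- The mirror image of `avoid_eq`, with the flow to the left; on the diagonal the two formulas are
combined. -/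
theorem StepData.meet_eq (h : StepData r s k f g D E) (hX : PathSums r s (r + k) f X Xn Xt)
    (hY : PathSums r s (r + k - 1) g Y Yn Yt) (i j : ℕ) (hi : k ≤ i) (hj1 : 1 ≤ j)
    (hj : j ≤ k + 1) : Yt i j = E i j * flowLeft D Xt i j := by
  have hks := h.lt
  refine descending_induction (N := r + k) (s := k)
    (p := fun i j => k ≤ i → 1 ≤ j → Yt i j = E i j * flowLeft D Xt i j)
    ?_ ?_ ?_ i j hj hi hj1
  · intro i j hj hi hki _
    have hm : ¬ IsMid r k i j := by unfold IsMid; omega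
    rw [hY.meet_eq_zero_of_eq_zero (by omega) (h.g0 i j hki (by omega) hm), h.E0 i j hm, zero_mul]
  · intro i _ _
    have : flowLeft D Xt i (k + 1) = 0 := Finset.sum_eq_zero fun i' _ => by
      rw [hX.meet_eq_zero h.fN h.f_diag i' _ (by omega) le_rfl, mul_zero]
    rw [hY.meet_eq_zero h.gN h.g_diag i _ (by omega) le_rfl, this, mul_zero]
  · intro i j hir hj h1 h2 hki hj1
    by_cases hm : IsMid r k i j
    · unfold IsMid at hm
      have hE := h.gE i j hm (by omega)
      have hB := h.DE i (j + 1) (by unfold IsMid; omega)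
      have hcons := h.flowLeft_conserved hX i j (by omega) hj1 hj
      by_cases hd : i + 1 = r + j
      · have hA : ¬ IsMid r k (i + 1) j := by unfold IsMid; omega
        have hq : ¬ IsMid r k (i + 2) (j + 1) := by unfold IsMid; omega
        rw [h.E0 _ _ hA, zero_add] at hE
        have hflow := h.flow hX i j hj (by omega)
        rw [h.D0 _ _ hA, add_zero, hX.eq_zero_of_eq_zero (i := i + 2) (by omega)
          (h.f0 _ _ (by omega) (by omega) hq), zero_add] at hflow
        rw [hY.diagt i j (by omega) hd, hY.step i j (by omega),
          hY.eq_zero_of_eq_zero (by omega) (h.g0 _ _ (by omega) (by omega) hA), zero_add,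
          hY.avoid_add_meet h.gN i (j + 1) (by omega), h.avoid_eq hX hY i (j + 1) hki (by omega),
          h2 hki (by omega), flowRight_succ i (j + 1) (by omega),
          h.flowRight_eq_zero (i + 1) (j + 1) (by omega), add_zero, ← hflow, hcons,
          hX.diagt (i + 1) (j + 1) (by omega) (by omega), ← hE]
        ring
      · have hA := h.DE (i + 1) j (by unfold IsMid; omega)
        rw [hY.stept i j (by omega) hd, h1 (by omega) hj1, h2 hki (by omega), flowLeft_succ, ← hE]
        calc _ = g i j * (E (i + 1) j * flowLeft D Xt i j +
              (D (i + 1) j * E (i + 1) j) * Xt (i + 1) (j + 1) +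
              E i (j + 1) * flowLeft D Xt i (j + 1)) := by ring
          _ = g i j * (E (i + 1) j * flowLeft D Xt i j +
              (D i (j + 1) * E i (j + 1)) * Xt (i + 1) (j + 1) +
              E i (j + 1) * flowLeft D Xt i (j + 1)) := by rw [hA, hB]
          _ = g i j * (E (i + 1) j * flowLeft D Xt i j +
              E i (j + 1) * (flowLeft D Xt i (j + 1) + D i (j + 1) * Xt (i + 1) (j + 1))) := by
                ring
          _ = _ := by rw [← hcons]; ring
    · rw [hY.meet_eq_zero_of_eq_zero (by omega) (h.g0 i j hki (by omega) hm), h.E0 i j hm,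
        zero_mul]

/-- In column `k` the flow to the left has a single term, so `E * D = 1` cancels; further left the
labels are just shifted by one row. -/
theorem StepData.meet_left_eq (h : StepData r s k f g D E) (hX : PathSums r s (r + k) f X Xn Xt)
    (hY : PathSums r s (r + k - 1) g Y Yn Yt) (i j : ℕ) (hi : i ≤ k) (hj1 : 1 ≤ j)
    (hj : j ≤ k + 1) : Yt i j = Xt i (j + 1) := by
  have hk := h.one_le
  have hks := h.lt
  have hsr := h.le
  have htop : ∀ i, Yt i (k + 1) = Xt i (k + 1 + 1) := fun i => by
    rw [hY.meet_eq_zero h.gN h.g_diag i _ (by omega) le_rfl,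
      hX.meet_eq_zero h.fN h.f_diag i _ (by omega) le_rfl]
  have hmid : ∀ j, 1 ≤ j → j ≤ k → Yt k j = Xt k (j + 1) := fun j hj1 hj => by
    have hlow : flowLeft D Xt k j = D k j * Xt k (j + 1) := by
      refine Finset.sum_eq_single_of_mem k (by simp) fun i' hi' hne => ?_
      rw [Finset.mem_range] at hi'
      rw [h.D0 i' j (by unfold IsMid; omega), zero_mul]
    rw [h.meet_eq hX hY k j le_rfl hj1 (by omega), hlow, ← mul_assoc, mul_comm (E k j),
      h.DE k j (by unfold IsMid; omega), one_mul]
  refine descending_induction (N := k - 1) (s := k)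
    (p := fun i j => i ≤ k → 1 ≤ j → Yt i j = Xt i (j + 1)) ?_ ?_ ?_ i j hj hi hj1
  · intro i j hj hi hik hj1
    obtain rfl : i = k := by omega
    exact hmid j hj1 hj
  · exact fun i _ _ => htop i
  · intro i j hik hj h1 h2 _ hj1
    rw [hY.stept i j (by omega) (by omega), hX.stept i (j + 1) (by omega) (by omega),
      h.left i j (by omega) hj1, h1 (by omega) hj1, h2 (by omega) (by omega)]

/-- No flow enters row 1 from below, so the flow to the right of `(k, 1)` is what the source sends
to `(k + 1, 1)`. The arbitrary label `a` cancels in `D * E`. -/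
theorem StepData.avoid_corner_eq (h : StepData r s k f g D E)
    (hX : PathSums r s (r + k) f X Xn Xt) (hY : PathSums r s (r + k - 1) g Y Yn Yt) :
    Yn k 1 = X (k + 1) 1 := by
  have hsr := h.le
  have hks := h.lt
  have h1 := h.flowRight_conserved hX k 0 le_rfl (by omega)
  have h0 : flowRight (r + k) D X k 0 = 0 := Finset.sum_eq_zero fun i' _ => by
    rw [h.D0 i' 0 (by unfold IsMid; omega), zero_mul]
  rw [h0, zero_add, zero_add] at h1
  rw [h.avoid_eq hX hY k 1 le_rfl (by omega), h1, ← mul_assoc, mul_comm (E k 1),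
    h.DE k 1 (by unfold IsMid; omega), one_mul]

/-- The step from `inter r s (k + 1)` to `inter r s k` preserves the total weight of paths. -/
theorem StepData.pathTotal_eq (h : StepData r s k f g D E) (hX : PathSums r s (r + k) f X Xn Xt)
    (hY : PathSums r s (r + k - 1) g Y Yn Yt) : pathTotal k Y Yt = pathTotal (k + 1) X Xt := by
  have hk := h.one_le
  have hks := h.lt
  unfold pathTotal
  rw [Finset.sum_Ico_succ_top hk, hY.avoid_add_meet h.gN k 1 (by omega),
    h.avoid_corner_eq hX hY, h.meet_left_eq hX hY k 1 le_rfl le_rfl (by omega),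
    Finset.sum_congr rfl fun i hi => ?_]
  rotate_left
  · exact fun i => Xt i (k + 1 + 1 - i)
  · rw [Finset.mem_Ico] at hi
    rw [h.meet_left_eq hX hY i (k + 1 - i) (by omega) (by omega) (by omega)]
    congr 1
    omega
  · rw [show k + 1 + 1 - k = 1 + 1 by omega]
    ring

end PathSums

/-! ### Real labelings as tropical labelings, extended by the tropical zero. -/

section TropicalLabels

/-- A real number as a tropical number. Tropical numbers add by minima, hence the sign. -/
def tau (a : ℝ) : Tropical (WithTop ℝ) := Tropical.trop ((-a : ℝ) : WithTop ℝ)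

theorem tau_injective : Function.Injective tau := fun a b h => by
  simpa [tau, WithTop.coe_inj] using h

theorem tau_zero : tau 0 = 1 := by simp [tau]

theorem tau_add (a b : ℝ) : tau (a + b) = tau a * tau b := by
  rw [tau, tau, tau, ← Tropical.trop_add, ← WithTop.coe_add, neg_add]

theorem tau_add_tau_of_le {a b : ℝ} (h : b ≤ a) : tau a + tau b = tau a := by
  apply Tropical.untrop_injective
  rw [Tropical.untrop_add]
  exact min_eq_left (WithTop.coe_le_coe.2 (neg_le_neg h))

theorem tau_add_sum {ι : Type*} {s : Finset ι} {f : ι → Tropical (WithTop ℝ)} {w : ℝ}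
    (h : ∀ i ∈ s, tau w + f i = tau w) : tau w + ∑ i ∈ s, f i = tau w := by
  classical
  induction s using Finset.induction_on with
  | empty => simp
  | insert i s hi ih =>
    rw [Finset.sum_insert hi, ← add_assoc, h i (Finset.mem_insert_self _ _),
      ih fun j hj => h j (Finset.mem_insert_of_mem hj)]

theorem sum_tau_eq {ι : Type*} {s : Finset ι} {c : ι → ℝ} {w : ℝ} (hle : ∀ i ∈ s, c i ≤ w)
    (hex : ∃ i ∈ s, c i = w) : ∑ i ∈ s, tau (c i) = tau w := by
  classical
  obtain ⟨i, hi, h⟩ := hex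
  rw [← Finset.add_sum_erase _ _ hi, h]
  exact tau_add_sum fun j hj => tau_add_tau_of_le (hle j (Finset.mem_of_mem_erase hj))

/-- A labeling of a finite set of pairs as a tropical labeling of all pairs. -/
def ext {S : Finset (ℕ × ℕ)} (x : S → ℝ) (i j : ℕ) : Tropical (WithTop ℝ) :=
  if h : (i, j) ∈ S then tau (x ⟨(i, j), h⟩) else 0

variable {S : Finset (ℕ × ℕ)}

theorem ext_of_mem (x : S → ℝ) {i j : ℕ} (h : (i, j) ∈ S) : ext x i j = tau (x ⟨(i, j), h⟩) :=
  dif_pos h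

theorem ext_of_notMem (x : S → ℝ) {i j : ℕ} (h : (i, j) ∉ S) : ext x i j = 0 := dif_neg h

/-- A neighbour outside `S` contributes the tropical zero and drops out of the maximum. -/
theorem tau_eq_mul_ext_add_ext {x d : S → ℝ} {p : S} {i j i' j' : ℕ}
    (hle : ∀ q : S, q.1 = (i, j) ∨ q.1 = (i', j') → x p + d q ≤ d p)
    (hex : ∃ q : S, (q.1 = (i, j) ∨ q.1 = (i', j')) ∧ d p = x p + d q) :
    tau (d p) = tau (x p) * (ext d i j + ext d i' j') := by
  have habs : ∀ i₀ j₀, ((i₀, j₀) = (i, j) ∨ (i₀, j₀) = (i', j')) →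
      tau (d p) + tau (x p) * ext d i₀ j₀ = tau (d p) := by
    intro i₀ j₀ h
    by_cases hm : (i₀, j₀) ∈ S
    · rw [ext_of_mem d hm, ← tau_add]
      exact tau_add_tau_of_le (hle ⟨_, hm⟩ h)
    · rw [ext_of_notMem d hm, mul_zero, add_zero]
  obtain ⟨⟨⟨i₀, j₀⟩, hm⟩, hq, h⟩ := hex
  have hd : tau (x p) * ext d i₀ j₀ = tau (d p) := by rw [h, tau_add, ext_of_mem d hm]
  rw [mul_add]
  rcases hq with hq | hq
  · obtain ⟨rfl, rfl⟩ := Prod.mk.inj hq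
    rw [hd, habs i' j' (Or.inr rfl)]
  · obtain ⟨rfl, rfl⟩ := Prod.mk.inj hq
    rw [hd, add_comm, habs i j (Or.inl rfl)]

/-- From every point of `S` one can walk inside `S` to every larger point by unit steps. -/
def StepsUp (S : Finset (ℕ × ℕ)) : Prop := ∀ i j i' j', (i, j) ∈ S → (i', j') ∈ S →
  i ≤ i' → j ≤ j' → (i, j) ≠ (i', j') →
    ((i + 1, j) ∈ S ∧ i + 1 ≤ i') ∨ ((i, j + 1) ∈ S ∧ j + 1 ≤ j')

/-- From every point of `S` one can walk inside `S` to every smaller point by unit steps. -/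
def StepsDown (S : Finset (ℕ × ℕ)) : Prop := ∀ i j i' j', (i, j) ∈ S → (i' + 1, j' + 1) ∈ S →
  i ≤ i' + 1 → j ≤ j' + 1 → (i, j) ≠ (i' + 1, j' + 1) →
    ((i', j' + 1) ∈ S ∧ i ≤ i') ∨ ((i' + 1, j') ∈ S ∧ j ≤ j')

theorem covBy_right {i j : ℕ} (h : (i, j) ∈ S) (h' : (i + 1, j) ∈ S) :
    (⟨(i, j), h⟩ : S) ⋖ ⟨(i + 1, j), h'⟩ := by
  refine ⟨Subtype.mk_lt_mk.2 (by simp [Prod.mk_lt_mk]), ?_⟩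
  rintro ⟨⟨a, b⟩, hab⟩ h1 h2
  simp only [Subtype.mk_lt_mk, Prod.mk_lt_mk] at h1 h2
  omega

theorem covBy_up {i j : ℕ} (h : (i, j) ∈ S) (h' : (i, j + 1) ∈ S) :
    (⟨(i, j), h⟩ : S) ⋖ ⟨(i, j + 1), h'⟩ := by
  refine ⟨Subtype.mk_lt_mk.2 (by simp [Prod.mk_lt_mk]), ?_⟩
  rintro ⟨⟨a, b⟩, hab⟩ h1 h2
  simp only [Subtype.mk_lt_mk, Prod.mk_lt_mk] at h1 h2
  omega

theorem ext_copsi (hS : StepsUp S) (x : S → ℝ) {i j : ℕ} (h : (i, j) ∈ S)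
    (hmax : ¬ IsMax (⟨(i, j), h⟩ : S)) :
    ext (copsi x) i j = ext x i j * (ext (copsi x) (i + 1) j + ext (copsi x) i (j + 1)) := by
  rw [ext_of_mem _ h, ext_of_mem x h]
  refine tau_eq_mul_ext_add_ext ?_ ?_
  · rintro ⟨q, hq⟩ (rfl | rfl)
    · exact add_copsi_le (covBy_right h hq) x
    · exact add_copsi_le (covBy_up h hq) x
  · obtain ⟨q, hq, hqx⟩ := exists_copsi_eq hmax x
    refine ⟨q, ?_, hqx⟩
    obtain ⟨⟨a, b⟩, hab⟩ := q
    have hlt := Prod.mk_le_mk.1 (Subtype.mk_le_mk.1 hq.le)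
    have hne : (i, j) ≠ (a, b) := fun e => hq.ne (Subtype.ext e)
    rcases hS i j a b h hab hlt.1 hlt.2 hne with ⟨hm, hle⟩ | ⟨hm, hle⟩
    · left
      have := hq.eq_or_eq (covBy_right h hm).le (Subtype.mk_le_mk.2 (Prod.mk_le_mk.2 ⟨hle, hlt.2⟩))
      rcases this with e | e
      · simp at e
      · exact congrArg Subtype.val e.symm
    · right
      have := hq.eq_or_eq (covBy_up h hm).le (Subtype.mk_le_mk.2 (Prod.mk_le_mk.2 ⟨hlt.1, hle⟩))
      rcases this with e | e
      · simp at e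
      · exact congrArg Subtype.val e.symm

theorem ext_psi (hS : StepsDown S) (x : S → ℝ) {i j : ℕ} (h : (i + 1, j + 1) ∈ S)
    (hmin : ¬ IsMin (⟨(i + 1, j + 1), h⟩ : S)) :
    ext (psi x) (i + 1) (j + 1) =
      ext x (i + 1) (j + 1) * (ext (psi x) i (j + 1) + ext (psi x) (i + 1) j) := by
  rw [ext_of_mem _ h, ext_of_mem x h]
  refine tau_eq_mul_ext_add_ext ?_ ?_
  · rintro ⟨q, hq⟩ (rfl | rfl)
    · exact add_psi_le (covBy_right hq h) x
    · exact add_psi_le (covBy_up hq h) x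
  · obtain ⟨q, hq, hqx⟩ := exists_psi_eq hmin x
    refine ⟨q, ?_, hqx⟩
    obtain ⟨⟨a, b⟩, hab⟩ := q
    have hlt := Prod.mk_le_mk.1 (Subtype.mk_le_mk.1 hq.le)
    have hne : (a, b) ≠ (i + 1, j + 1) := fun e => hq.ne (Subtype.ext e)
    rcases hS a b i j hab h hlt.1 hlt.2 hne with ⟨hm, hle⟩ | ⟨hm, hle⟩
    · left
      have := hq.eq_or_eq (Subtype.mk_le_mk.2 (Prod.mk_le_mk.2 ⟨hle, hlt.2⟩)) (covBy_right hm h).le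
      rcases this with e | e
      · exact congrArg Subtype.val e.symm
      · simp at e
    · right
      have := hq.eq_or_eq (Subtype.mk_le_mk.2 (Prod.mk_le_mk.2 ⟨hlt.1, hle⟩)) (covBy_up hm h).le
      rcases this with e | e
      · exact congrArg Subtype.val e.symm
      · simp at e

/-- In a set with a greatest element, the path sums of a labeling are given by `copsi`. -/
theorem PathSums.eq_ext_copsi {r s e : ℕ} {X Xn Xt : ℕ → ℕ → Tropical (WithTop ℝ)}
    (hS : StepsUp S) (htop : (e, s) ∈ S) (hle : ∀ i j, (i, j) ∈ S → i ≤ e ∧ j ≤ s) {x : S → ℝ}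
    (hX : PathSums r s e (ext x) X Xn Xt) (i j : ℕ) (hj : j ≤ s) :
    X i j = ext (copsi x) i j := by
  refine descending_induction (N := e) (s := s) (p := fun i j => j ≤ s → X i j = ext (copsi x) i j)
    (fun i j hj hi _ => ?_) (fun i hi => by omega) (fun i j hi hj h1 h2 _ => ?_) i j (by omega) hj
  · have hm : (i, j) ∉ S := fun hm => by have := hle i j hm; omega
    rw [hX.eq_zero_of_eq_zero hj (ext_of_notMem x hm), ext_of_notMem _ hm]
  · by_cases hm : (i, j) ∈ S
    · by_cases hmax : (i, j) = (e, s)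
      · obtain ⟨rfl, rfl⟩ := Prod.mk.inj hmax
        have hm' : (i + 1, j) ∉ S := fun hm => by have := hle _ _ hm; omega
        have hM : IsMax (⟨(i, j), hm⟩ : S) := fun q hq => by
          exact Subtype.mk_le_mk.2 (Prod.mk_le_mk.2 (hle q.1.1 q.1.2 q.2))
        rw [hX.step i j le_rfl, hX.top, if_pos rfl, h1 le_rfl, ext_of_notMem _ hm', zero_add, mul_one,
          ext_of_mem _ hm, ext_of_mem _ hm, copsi_of_isMax hM]
      · have hM : ¬ IsMax (⟨(i, j), hm⟩ : S) := fun hM => by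
          have := hM (b := ⟨(e, s), htop⟩) (Subtype.mk_le_mk.2 (Prod.mk_le_mk.2 (hle i j hm)))
          have h1 := Prod.mk_le_mk.1 (Subtype.mk_le_mk.1 this)
          exact hmax (Prod.ext (by have := hle i j hm; simp; omega)
            (by have := hle i j hm; simp; omega))
        rw [hX.step i j hj, h1 hj, ext_copsi hS x hm hM]
        rcases hj.eq_or_lt with rfl | hlt
        · have hne : i ≠ e := fun h => hmax (by rw [h])
          rw [hX.top, if_neg hne, ext_of_notMem (copsi x) (i := i) (j := j + 1) fun hm => by
            have := hle _ _ hm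
            omega]
        · rw [h2 hlt]
    · rw [hX.eq_zero_of_eq_zero hj (ext_of_notMem x hm), ext_of_notMem _ hm]

end TropicalLabels

/-! ### Shapes of the posets, and the flow data of one step. -/

section Shapes

variable {r s k : ℕ}

theorem mem_rect {i j : ℕ} : (i, j) ∈ rect r s ↔ (1 ≤ i ∧ 1 ≤ j) ∧ i ≤ r ∧ j ≤ s := by
  simp [rect]

theorem mem_trap {i j : ℕ} :
    (i, j) ∈ trap r s ↔ 1 ≤ i ∧ 1 ≤ j ∧ j ≤ s ∧ i + 1 ≤ r + j ∧ s < i + j := by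
  simp only [trap, rightTrap, rect, Finset.mem_filter, Finset.mem_Icc, Prod.mk_le_mk]
  omega

theorem mem_mid (hk : 1 ≤ k) (hks : k < s) {i j : ℕ} :
    (i, j) ∈ mid r s k ↔ IsMid r k i j := by
  simp only [mid, rightTrap, rect, Finset.mem_filter, Finset.mem_Icc, Prod.mk_le_mk, IsMid]
  omega

theorem mem_inter (hk : 1 ≤ k) (hks : k ≤ s) {i j : ℕ} :
    (i, j) ∈ inter r s k ↔ 1 ≤ i ∧ 1 ≤ j ∧ j ≤ s ∧ i + 1 ≤ r + j ∧
      ((j ≤ k ∧ k < i + j) ∨ (k ≤ i ∧ i + 1 ≤ r + k ∧ k < j)) := by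
  simp only [inter, trap, rightTrap, rect, Finset.mem_filter, Finset.mem_Icc, Prod.mk_le_mk]
  omega

theorem stepsUp_rect : StepsUp (rect r s) := by
  intro i j i' j' h h' hi hj hne
  rw [Ne, Prod.mk.injEq] at hne
  rw [mem_rect] at h h' ⊢
  rw [mem_rect]
  omega

theorem stepsUp_trap : StepsUp (trap r s) := by
  intro i j i' j' h h' hi hj hne
  rw [Ne, Prod.mk.injEq] at hne
  rw [mem_trap] at h h' ⊢
  rw [mem_trap]
  omega

theorem stepsUp_mid (hk : 1 ≤ k) (hks : k < s) : StepsUp (mid r s k) := by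
  intro i j i' j' h h' hi hj hne
  rw [Ne, Prod.mk.injEq] at hne
  rw [mem_mid hk hks] at h h' ⊢
  rw [mem_mid hk hks]
  unfold IsMid at *
  omega

theorem stepsDown_mid (hk : 1 ≤ k) (hks : k < s) : StepsDown (mid r s k) := by
  intro i j i' j' h h' hi hj hne
  rw [Ne, Prod.mk.injEq] at hne
  rw [mem_mid hk hks] at h h' ⊢
  rw [mem_mid hk hks]
  unfold IsMid at *
  omega

/-- The minimum of `mid r s k`. -/
def midMin (hk : 1 ≤ k) (hks : k < s) (hsr : s ≤ r) : mid r s k :=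
  ⟨(k, 1), (mem_mid hk hks).2 (by unfold IsMid; omega)⟩

/-- The maximum of `mid r s k`. -/
def midMax (r : ℕ) (hk : 1 ≤ k) (hks : k < s) : mid r s k :=
  ⟨(r + k, k + 1), (mem_mid hk hks).2 (by unfold IsMid; omega)⟩

theorem isBot_midMin (hk : 1 ≤ k) (hks : k < s) (hsr : s ≤ r) : IsBot (midMin hk hks hsr) := by
  rintro ⟨⟨i, j⟩, h⟩
  have h' := (mem_mid hk hks).1 h
  unfold IsMid at h'
  exact Subtype.mk_le_mk.2 (Prod.mk_le_mk.2 (by omega))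

theorem isTop_midMax (hk : 1 ≤ k) (hks : k < s) : IsTop (midMax r hk hks) := by
  rintro ⟨⟨i, j⟩, h⟩
  have h' := (mem_mid hk hks).1 h
  unfold IsMid at h'
  exact Subtype.mk_le_mk.2 (Prod.mk_le_mk.2 (by omega))

theorem not_isMin_of_ne_midMin (hk : 1 ≤ k) (hks : k < s) (hsr : s ≤ r) {p : mid r s k}
    (hp : p.1 ≠ (k, 1)) : ¬ IsMin p := fun h =>
  hp (congrArg Subtype.val (h.eq_of_ge (isBot_midMin hk hks hsr p)))

theorem not_isMax_of_ne_midMax (hk : 1 ≤ k) (hks : k < s) {p : mid r s k}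
    (hp : p.1 ≠ (r + k, k + 1)) : ¬ IsMax p := fun h =>
  hp (congrArg Subtype.val (h.eq_of_le (isTop_midMax hk hks p)))

theorem mem_inter_succ_of_mem_mid (hk : 1 ≤ k) (hks : k < s) {p : ℕ × ℕ} (hp : p ∈ mid r s k)
    (hne : p ≠ (k, 1)) : p ∈ inter r s (k + 1) := by
  obtain ⟨i, j⟩ := p
  rw [mem_mid hk hks] at hp
  rw [mem_inter (by omega) (by omega)]
  rw [Ne, Prod.mk.injEq] at hne
  unfold IsMid at hp
  omega

theorem mem_inter_of_mem_mid (hk : 1 ≤ k) (hks : k < s) {p : ℕ × ℕ} (hp : p ∈ mid r s k)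
    (hne : p ≠ (r + k, k + 1)) : p ∈ inter r s k := by
  obtain ⟨i, j⟩ := p
  rw [mem_mid hk hks] at hp
  rw [mem_inter (by omega) (by omega)]
  rw [Ne, Prod.mk.injEq] at hne
  unfold IsMid at hp
  omega

theorem label_of_mem {S : Finset (ℕ × ℕ)} (x : S → ℝ) {p : ℕ × ℕ} (h : p ∈ S) :
    label x p = x ⟨p, h⟩ := dif_pos h

theorem ext_inter_eq_zero (x : inter r s k → ℝ) (i j : ℕ) (hi : r + s < i) : ext x i j = 0 := by
  refine ext_of_notMem x ?_
  simp only [inter, rightTrap, rect, Finset.mem_filter, Finset.mem_Icc, Prod.mk_le_mk]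
  omega

/-- The field `DE` is the rowmotion identity, and `fD`, `gE` are the recursions of `psi` and
`copsi`; the other fields concern only shapes and shifts. -/
theorem stepData_zetaStep (hk : 1 ≤ k) (hks : k < s) (hsr : s ≤ r) (L : LinExt (mid r s k))
    (a : ℝ) (x : inter r s (k + 1) → ℝ) :
    StepData r s k (ext x) (ext (zetaStep k L a x)) (ext (psi (bar a x)))
      (ext (copsi ((rowmotion L).symm (bar a x)))) where
  one_le := hk
  lt := hks
  le := hsr
  fN := ext_inter_eq_zero x
  gN := ext_inter_eq_zero _
  D0 i j h := ext_of_notMem _ (by rwa [mem_mid hk hks])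
  E0 i j h := ext_of_notMem _ (by rwa [mem_mid hk hks])
  DE i j h := by
    rw [← mem_mid hk hks] at h
    rw [ext_of_mem _ h, ext_of_mem _ h, ← tau_add, psi_add_copsi_rowmotion_symm, tau_zero]
  f0 i j hi hj h := ext_of_notMem _ (by
    rw [mem_inter (by omega) (by omega)]
    unfold IsMid at h
    omega)
  g0 i j hi hj h := ext_of_notMem _ (by
    rw [mem_inter (by omega) (by omega)]
    unfold IsMid at h
    omega)
  g_max := ext_of_notMem _ (by
    rw [mem_inter (by omega) (by omega)]
    omega)
  f_diag i j hj h := ext_of_notMem _ (by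
    rw [mem_inter (by omega) (by omega)]
    omega)
  g_diag i j hj h := ext_of_notMem _ (by
    rw [mem_inter (by omega) (by omega)]
    omega)
  fD i j h hmin := by
    rw [← mem_mid hk hks] at h
    have hne : (i + 1, j + 1) ≠ (k, 1) := by simpa using hmin
    have hx : ext x (i + 1) (j + 1) = ext (bar a x) (i + 1) (j + 1) := by
      have hm := mem_inter_succ_of_mem_mid hk hks h hne
      rw [ext_of_mem _ h, ext_of_mem x hm, bar, if_neg hne, label_of_mem x hm]
    rw [hx, ← ext_psi (stepsDown_mid hk hks) _ h (not_isMin_of_ne_midMin hk hks hsr hne)]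
  gE i j h hmax := by
    rw [← mem_mid hk hks] at h
    have hne : (i, j) ≠ (r + k, k + 1) := by simpa using hmax
    have hy : ext (zetaStep k L a x) i j = ext ((rowmotion L).symm (bar a x)) i j := by
      rw [ext_of_mem _ h, ext_of_mem _ (mem_inter_of_mem_mid hk hks h hne), zetaStep, dif_pos h]
    rw [hy, ← ext_copsi (stepsUp_mid hk hks) _ h (not_isMax_of_ne_midMax hk hks hne)]
  left i j hi hj := by
    by_cases h : (i, j) ∈ inter r s k
    · have h' : (i, j + 1) ∈ inter r s (k + 1) := by
        rw [mem_inter (by omega) (by omega)] at h ⊢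
        omega
      have hm : (i, j) ∉ mid r s k := by
        rw [mem_mid hk hks]
        unfold IsMid
        omega
      have hj : ¬ k + 1 < j := by
        rw [mem_inter (by omega) (by omega)] at h
        omega
      rw [ext_of_mem _ h, ext_of_mem _ h', zetaStep, dif_neg hm, if_neg hj, label_of_mem x h']
    · rw [ext_of_notMem _ h, ext_of_notMem]
      rw [mem_inter (by omega) (by omega)] at h ⊢
      omega
  above i j hj := by
    by_cases h : (i, j) ∈ inter r s k
    · have h' : (i + 1, j) ∈ inter r s (k + 1) := by
        rw [mem_inter (by omega) (by omega)] at h ⊢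
        omega
      have hm : (i, j) ∉ mid r s k := by
        rw [mem_mid hk hks]
        unfold IsMid
        omega
      rw [ext_of_mem _ h, ext_of_mem _ h', zetaStep, dif_neg hm, if_pos (show k + 1 < j by omega),
        label_of_mem x h']
    · rw [ext_of_notMem _ h, ext_of_notMem]
      rw [mem_inter (by omega) (by omega)] at h ⊢
      omega

end Shapes

/-! ### The path invariant and its values on trapezoid and rectangle. -/

section Weights

variable {r s : ℕ}

theorem exists_pathSums_inter (k : ℕ) (x : inter r s k → ℝ) :
    ∃ X Xn Xt, PathSums r s (r + k - 1) (ext x) X Xn Xt :=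
  exists_pathSums r s (r + k - 1) (ext_inter_eq_zero x)

/-- The tropical total weight of the paths in `inter r s k` that start in `(k, 1)` or meet the
diagonal. -/
def interWeight (k : ℕ) (x : inter r s k → ℝ) : Tropical (WithTop ℝ) :=
  pathTotal k (exists_pathSums_inter k x).choose
    (exists_pathSums_inter k x).choose_spec.choose_spec.choose

theorem exists_interWeight_eq (k : ℕ) (x : inter r s k → ℝ) : ∃ X Xn Xt,
    PathSums r s (r + k - 1) (ext x) X Xn Xt ∧ interWeight k x = pathTotal k X Xt :=
  ⟨_, _, _, (exists_pathSums_inter k x).choose_spec.choose_spec.choose_spec, rfl⟩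

theorem interWeight_zetaStep {k : ℕ} (hk : 1 ≤ k) (hks : k < s) (hsr : s ≤ r)
    (L : LinExt (mid r s k)) (a : ℝ) (x : inter r s (k + 1) → ℝ) :
    interWeight k (zetaStep k L a x) = interWeight (k + 1) x := by
  obtain ⟨X, Xn, Xt, hX, h⟩ := exists_interWeight_eq (k + 1) x
  obtain ⟨Y, Yn, Yt, hY, h'⟩ := exists_interWeight_eq k (zetaStep k L a x)
  rw [h, h']
  exact (stepData_zetaStep hk hks hsr L a x).pathTotal_eq hX hY

theorem interWeight_zetaComp (hsr : s ≤ r) (L : ∀ k, LinExt (mid r s k)) (a : ℕ → ℝ) (n : ℕ)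
    (hn : n + 1 ≤ s) (x : inter r s (n + 1) → ℝ) :
    interWeight 1 (zetaComp L a n x) = interWeight (n + 1) x := by
  induction n with
  | zero => rfl
  | succ n ih =>
    rw [← interWeight_zetaStep (by omega) (by omega) hsr (L (n + 1)) (a (n + 1)) x, ← ih (by omega)]
    rfl

theorem ext_congr {S T : Finset (ℕ × ℕ)} (h : S = T) {x : S → ℝ} {y : T → ℝ}
    (hxy : ∀ p (hp : p ∈ S) (hp' : p ∈ T), x ⟨p, hp⟩ = y ⟨p, hp'⟩) : ext x = ext y := by
  subst h
  congr 1
  funext p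
  exact hxy p.1 p.2 p.2

/-- The maximum of the rectangle. -/
def rectMax (hs : 1 ≤ s) (hsr : s ≤ r) : rect r s := ⟨(r, s), mem_rect.2 (by omega)⟩

theorem isTop_rectMax (hs : 1 ≤ s) (hsr : s ≤ r) : IsTop (rectMax hs hsr) := by
  rintro ⟨⟨i, j⟩, h⟩
  exact Subtype.mk_le_mk.2 (Prod.mk_le_mk.2 (mem_rect.1 h).2)

/-- The maximum of the trapezoid. -/
def trapMax (hs : 1 ≤ s) (hsr : s ≤ r) : trap r s := ⟨(r + s - 1, s), mem_trap.2 (by omega)⟩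

theorem isTop_trapMax (hs : 1 ≤ s) (hsr : s ≤ r) : IsTop (trapMax hs hsr) := by
  rintro ⟨⟨i, j⟩, h⟩
  have h' := mem_trap.1 h
  exact Subtype.mk_le_mk.2 (Prod.mk_le_mk.2 (by omega))

theorem interWeight_one (hs : 1 ≤ s) (hsr : s ≤ r) {x : inter r s 1 → ℝ} {z : rect r s → ℝ}
    (hxz : ∀ p (hp : p ∈ inter r s 1) (hp' : p ∈ rect r s), x ⟨p, hp⟩ = z ⟨p, hp'⟩) :
    interWeight 1 x = tau (psi z (rectMax hs hsr)) := by
  obtain ⟨X, Xn, Xt, hX, h⟩ := exists_interWeight_eq 1 x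
  rw [ext_congr (inter_one r s hs) hxz] at hX
  have h11 : (1, 1) ∈ rect r s := mem_rect.2 (by omega)
  have hbot : IsBot (⟨(1, 1), h11⟩ : rect r s) := by
    rintro ⟨⟨i, j⟩, h⟩
    exact Subtype.mk_le_mk.2 (Prod.mk_le_mk.2 (mem_rect.1 h).1)
  have := hX.eq_ext_copsi stepsUp_rect (mem_rect.2 (by omega))
    (fun i j h => (mem_rect.1 h).2) 1 1 hs
  rw [h, pathTotal, Finset.Ico_self, Finset.sum_empty, add_zero, this, ext_of_mem _ h11,
    copsi_of_isBot hbot, psi_of_isTop (isTop_rectMax hs hsr)]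

theorem interWeight_self (hs : 1 ≤ s) (hsr : s ≤ r) {x : inter r s s → ℝ} {z : trap r s → ℝ}
    (hxz : ∀ p (hp : p ∈ inter r s s) (hp' : p ∈ trap r s), x ⟨p, hp⟩ = z ⟨p, hp'⟩) :
    interWeight s x = tau (psi z (trapMax hs hsr)) := by
  obtain ⟨X, Xn, Xt, hX, h⟩ := exists_interWeight_eq s x
  rw [ext_congr (inter_self r s) hxz] at hX
  have hz : ∀ i j, r + s < i → ext z i j = 0 := fun i j hi => ext_of_notMem _ (by
    rw [mem_trap]
    omega)
  -- The exit column `r + s - 1` meets row `s` on the diagonal, so no path avoids it.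
  have hn : ∀ i j, j ≤ s + 1 → j ≤ s → Xn i j = 0 := by
    refine descending_induction (N := r + s) (fun i j hj hi _ => ?_) (fun i hi => by omega)
      fun i j _ hj h1 h2 _ => ?_
    · exact hX.avoid_eq_zero_of_eq_zero hj (hz i j hi)
    · by_cases hd : i + 1 = r + j
      · exact hX.diagn i j hj hd
      · rw [hX.stepn i j hj hd, h1 hj, zero_add]
        rcases hj.eq_or_lt with rfl | hj
        · rw [hX.topn, if_neg (by omega), mul_zero]
        · rw [h2 hj, mul_zero]
  have hXt : ∀ i j, j ≤ s → Xt i j = ext (copsi z) i j := fun i j hj => by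
    rw [← hX.eq_ext_copsi stepsUp_trap (mem_trap.2 (by omega))
      (fun i j h => by have := mem_trap.1 h; omega) i j hj,
      hX.avoid_add_meet hz i j (by omega), hn i j (by omega) hj, zero_add]
  have hs1 : X s 1 = Xt s (s + 1 - s) := by
    rw [Nat.add_sub_cancel_left, hX.avoid_add_meet hz s 1 (by omega), hn s 1 (by omega) hs,
      zero_add]
  let c : ℕ → ℝ := fun i => label (copsi z) (i, s + 1 - i)
  have hmem : ∀ i, 1 ≤ i → i < s + 1 → (i, s + 1 - i) ∈ trap r s := fun i h1 h2 =>
    mem_trap.2 (by omega)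
  -- The term from `(s, 1)` joins the sum, which now runs over all minimal elements `(i, s + 1 - i)`
  -- of the trapezoid.
  rw [h, pathTotal, hs1, add_comm, ← Finset.sum_Ico_succ_top hs fun i => Xt i (s + 1 - i),
    psi_of_isTop (isTop_trapMax hs hsr)]
  have hc : ∀ i ∈ Finset.Ico 1 (s + 1), Xt i (s + 1 - i) = tau (c i) := fun i hi => by
    rw [Finset.mem_Ico] at hi
    rw [hXt i _ (by omega), ext_of_mem _ (hmem i hi.1 hi.2)]
    exact congrArg tau (label_of_mem _ (hmem i hi.1 hi.2)).symm
  rw [Finset.sum_congr rfl hc]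
  refine sum_tau_eq (fun i hi => ?_) ?_
  · rw [Finset.mem_Ico] at hi
    show label (copsi z) (i, s + 1 - i) ≤ _
    rw [label_of_mem _ (hmem i hi.1 hi.2)]
    refine copsi_le_maxWeight ?_ z
    rintro ⟨⟨i', j'⟩, h'⟩ hle
    have h1 := mem_trap.1 h'
    have h2 := Prod.mk_le_mk.1 (Subtype.mk_le_mk.1 hle)
    exact Subtype.mk_le_mk.2 (Prod.mk_le_mk.2 (by omega))
  · have : Nonempty (trap r s) := ⟨trapMax hs hsr⟩
    obtain ⟨⟨⟨i, j⟩, hp⟩, hmin, hw⟩ := exists_copsi_eq_maxWeight z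
    have h1 := mem_trap.1 hp
    have hij : i + j = s + 1 := by
      by_contra hne
      have hm : (i - 1, j) ∈ trap r s := mem_trap.2 (by omega)
      have := hmin (b := ⟨(i - 1, j), hm⟩) (Subtype.mk_le_mk.2 (Prod.mk_le_mk.2 (by omega)))
      have := Prod.mk_le_mk.1 (Subtype.mk_le_mk.1 this)
      omega
    obtain rfl : j = s + 1 - i := by omega
    refine ⟨i, Finset.mem_Ico.2 (by omega), ?_⟩
    show label (copsi z) (i, s + 1 - i) = _
    rw [label_of_mem _ hp, hw]

theorem psi_zeta_rectMax (hs : 1 ≤ s) (hsr : s ≤ r) (L : ∀ k, LinExt (mid r s k)) (a : ℕ → ℝ)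
    (x : trap r s → ℝ) : psi (zeta L a x) (rectMax hs hsr) = psi x (trapMax hs hsr) := by
  obtain ⟨n, rfl⟩ : ∃ n, s = n + 1 := ⟨s - 1, by omega⟩
  apply tau_injective
  rw [← interWeight_self hs hsr (x := fun q : inter r (n + 1) (n + 1) => label x q.1)
      fun p hp hp' => label_of_mem x hp',
    ← interWeight_zetaComp hsr L a n le_rfl]
  exact (interWeight_one hs hsr fun p hp hp' => (label_of_mem _ hp).symm).symm

end Weights

/-! ### Bijectivity on natural labelings and on plane partitions. -/

section Bijectivity

variable {r s k : ℕ}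

theorem isNatLabeling_label {S : Finset (ℕ × ℕ)} {x : S → ℝ} (hx : IsNatLabeling x) (p : ℕ × ℕ) :
    ∃ n : ℕ, label x p = n := by
  by_cases h : p ∈ S
  · rw [label_of_mem x h]
    exact hx _
  · exact ⟨0, by simp [label, h]⟩

theorem isNatLabeling_zetaStep (hk : 1 ≤ k) (hks : k < s) (hsr : s ≤ r) (L : LinExt (mid r s k))
    (a : ℝ) {x : inter r s (k + 1) → ℝ} (hx : IsNatLabeling x) :
    IsNatLabeling (zetaStep k L a x) := by
  rintro ⟨p, hp⟩
  unfold zetaStep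
  split_ifs with h
  · refine exists_nat_of_psi_add_copsi (isBot_midMin hk hks hsr)
      (psi_add_copsi_rowmotion_symm L (bar a x)) (fun q hq => ?_)
      (not_isMax_of_ne_midMax hk hks (p := ⟨p, h⟩) ?_)
    · have : q.1 ≠ (k, 1) := fun h => hq (Subtype.ext h)
      rw [bar, if_neg this]
      exact isNatLabeling_label hx _
    · rintro rfl
      rw [mem_inter (by omega) (by omega)] at hp
      omega
  · exact isNatLabeling_label hx _
  · exact isNatLabeling_label hx _

/-- The image forgets only the label at the maximum of the middle part. That label enters `copsi` at
the minimum additively, and this value must be `-a`. -/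
theorem zetaStep_injective (hk : 1 ≤ k) (hks : k < s) (hsr : s ≤ r) (L : LinExt (mid r s k))
    (a : ℝ) : Function.Injective (zetaStep k L a) := by
  intro x x' hxx
  set t := midMax r hk hks
  set b := midMin hk hks hsr
  have hbar : bar a x = bar a x' := by
    set y := (rowmotion L).symm (bar a x) with hy
    set y' := (rowmotion L).symm (bar a x') with hy'
    have hyy : y' = Function.update y t (y' t) := by
      funext p
      by_cases hp : p = t
      · rw [hp, Function.update_self]
      · rw [Function.update_of_ne hp]
        have hm : p.1 ∈ inter r s k :=
          mem_inter_of_mem_mid hk hks p.2 fun h => hp (Subtype.ext h)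
        have h := congrFun hxx ⟨p.1, hm⟩
        unfold zetaStep at h
        rw [dif_pos p.2, dif_pos p.2] at h
        exact h.symm
    have hbx : ∀ w : inter r s (k + 1) → ℝ, psi (bar a w) b = a := fun w => by
      rw [psi_of_isMin (isBot_midMin hk hks hsr).isMin]
      exact if_pos rfl
    have h1 := psi_add_copsi_rowmotion_symm L (bar a x) b
    have h2 := psi_add_copsi_rowmotion_symm L (bar a x') b
    rw [← hy, hbx] at h1
    rw [← hy', hbx, hyy, copsi_update_of_isTop (isTop_midMax hk hks)] at h2
    have h3 : y' t = y t := by linarith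
    rw [h3, Function.update_eq_self] at hyy
    exact (rowmotion L).symm.injective hyy.symm
  funext ⟨⟨i, j⟩, hq⟩
  have hq' := hq
  rw [mem_inter (by omega) (by omega)] at hq'
  by_cases hm : (i, j) ∈ mid r s k
  · have h := congrFun hbar ⟨(i, j), hm⟩
    have hne : (i, j) ≠ (k, 1) := by
      rw [Ne, Prod.mk.injEq]
      omega
    unfold bar at h
    rwa [if_neg hne, if_neg hne, label_of_mem _ hq, label_of_mem _ hq] at h
  · have hm' := hm
    rw [mem_mid hk hks] at hm'
    unfold IsMid at hm'
    by_cases hj : k + 1 < j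
    · obtain ⟨i, rfl⟩ : ∃ i', i = i' + 1 := ⟨i - 1, by omega⟩
      have hp : (i, j) ∈ inter r s k := by
        rw [mem_inter (by omega) (by omega)]
        omega
      have hpm : (i, j) ∉ mid r s k := by
        rw [mem_mid hk hks]
        unfold IsMid
        omega
      have h := congrFun hxx ⟨(i, j), hp⟩
      unfold zetaStep at h
      rwa [dif_neg hpm, dif_neg hpm, if_pos hj, if_pos hj, label_of_mem _ hq,
        label_of_mem _ hq] at h
    · obtain ⟨j, rfl⟩ : ∃ j', j = j' + 1 := ⟨j - 1, by omega⟩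
      have hp : (i, j) ∈ inter r s k := by
        rw [mem_inter (by omega) (by omega)]
        omega
      have hpm : (i, j) ∉ mid r s k := by
        rw [mem_mid hk hks]
        unfold IsMid
        omega
      have hj' : ¬ k + 1 < j := by omega
      have h := congrFun hxx ⟨(i, j), hp⟩
      unfold zetaStep at h
      rwa [dif_neg hpm, dif_neg hpm, if_neg hj', if_neg hj', label_of_mem _ hq,
        label_of_mem _ hq] at h

theorem exists_zetaStep_eq (hk : 1 ≤ k) (hks : k < s) (hsr : s ≤ r) (L : LinExt (mid r s k))
    (a : ℝ) {w : inter r s k → ℝ} (hw : IsNatLabeling w) :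
    ∃ x, IsNatLabeling x ∧ zetaStep k L a x = w := by
  set t := midMax r hk hks
  set b := midMin hk hks hsr
  let y₀ : mid r s k → ℝ := fun p => label w p.1
  -- The label at `t` is chosen so that `copsi y b = -a`, which forces the label `a` at `b` after
  -- rowmotion.
  let y := Function.update y₀ t (y₀ t - a - copsi y₀ b)
  have hrel := psi_rowmotion_add_copsi L y
  have hxb : rowmotion L y b = a := by
    have h := hrel b
    rw [psi_of_isMin (isBot_midMin hk hks hsr).isMin,
      copsi_update_of_isTop (isTop_midMax hk hks)] at h
    linarith
  have hy : ∀ p : mid r s k, p ≠ t → y p = label w p.1 := fun p hp => Function.update_of_ne hp _ _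
  let x : inter r s (k + 1) → ℝ := fun q =>
    if h : q.1 ∈ mid r s k then rowmotion L y ⟨q.1, h⟩
    else if k + 1 < q.1.2 then label w (q.1.1 - 1, q.1.2)
    else label w (q.1.1, q.1.2 - 1)
  have hbar : bar a x = rowmotion L y := by
    funext p
    unfold bar
    split_ifs with h
    · rw [← hxb]
      exact congrArg (rowmotion L y) (Subtype.ext h.symm)
    · rw [label_of_mem x (mem_inter_succ_of_mem_mid hk hks p.2 h)]
      exact dif_pos p.2
  refine ⟨x, ?_, ?_⟩
  · rintro ⟨q, hq⟩
    show ∃ n : ℕ, (if h : q ∈ mid r s k then rowmotion L y ⟨q, h⟩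
      else if k + 1 < q.2 then label w (q.1 - 1, q.2) else label w (q.1, q.2 - 1)) = n
    split_ifs with h
    · refine exists_nat_of_copsi_add_psi (isTop_midMax hk hks) hrel (fun p hp => ?_)
        (not_isMin_of_ne_midMin hk hks hsr ?_)
      · rw [hy p hp]
        exact isNatLabeling_label hw _
      · rintro rfl
        rw [mem_inter (by omega) (by omega)] at hq
        omega
    · exact isNatLabeling_label hw _
    · exact isNatLabeling_label hw _
  · funext ⟨⟨i, j⟩, hp⟩
    have hp' := hp
    rw [mem_inter (by omega) (by omega)] at hp'
    unfold zetaStep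
    rw [hbar, Equiv.symm_apply_apply]
    split_ifs with h hj
    · rw [hy _ fun h => ?_, label_of_mem w hp]
      have h0 : (i, j) = (r + k, k + 1) := congrArg Subtype.val h
      rw [Prod.mk.injEq] at h0
      omega
    · rw [mem_mid hk hks] at h
      unfold IsMid at h
      simp only at hj
      have hq : (i + 1, j) ∈ inter r s (k + 1) := by
        rw [mem_inter (by omega) (by omega)]
        omega
      have hqm : (i + 1, j) ∉ mid r s k := by
        rw [mem_mid hk hks]
        unfold IsMid
        omega
      rw [label_of_mem x hq]
      show (if h : (i + 1, j) ∈ mid r s k then rowmotion L y ⟨(i + 1, j), h⟩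
        else if k + 1 < j then label w (i + 1 - 1, j) else label w (i + 1, j - 1)) = _
      rw [dif_neg hqm, if_pos hj, Nat.add_sub_cancel, label_of_mem w hp]
    · rw [mem_mid hk hks] at h
      unfold IsMid at h
      simp only at hj
      have hq : (i, j + 1) ∈ inter r s (k + 1) := by
        rw [mem_inter (by omega) (by omega)]
        omega
      have hqm : (i, j + 1) ∉ mid r s k := by
        rw [mem_mid hk hks]
        unfold IsMid
        omega
      rw [label_of_mem x hq]
      show (if h : (i, j + 1) ∈ mid r s k then rowmotion L y ⟨(i, j + 1), h⟩
        else if k + 1 < j + 1 then label w (i - 1, j + 1) else label w (i, j + 1 - 1)) = _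
      rw [dif_neg hqm, if_neg (by omega), Nat.add_sub_cancel, label_of_mem w hp]

theorem bijOn_zetaComp (hsr : s ≤ r) (L : ∀ k, LinExt (mid r s k)) (a : ℕ → ℝ) (n : ℕ)
    (hn : n + 1 ≤ s) :
    Set.BijOn (zetaComp L a n) {x | IsNatLabeling x} {x | IsNatLabeling x} := by
  induction n with
  | zero => exact Set.bijOn_id _
  | succ n ih =>
    refine (ih (by omega)).comp (g := zetaComp L a n) ⟨?_, ?_, ?_⟩
    · exact fun x hx => isNatLabeling_zetaStep (by omega) (by omega) hsr _ _ hx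
    · exact (zetaStep_injective (by omega) (by omega) hsr _ _).injOn
    · exact fun w hw => exists_zetaStep_eq (by omega) (by omega) hsr _ _ hw

theorem bijOn_label {S T : Finset (ℕ × ℕ)} (h : S = T) :
    Set.BijOn (fun (x : S → ℝ) (p : T) => label x p.1) {x | IsNatLabeling x}
      {x | IsNatLabeling x} := by
  subst h
  convert Set.bijOn_id _ using 1
  funext x p
  exact label_of_mem x p.2

theorem bijOn_zeta (hs : 1 ≤ s) (hsr : s ≤ r) (L : ∀ k, LinExt (mid r s k)) (a : ℕ → ℝ) :
    Set.BijOn (zeta L a) {x | IsNatLabeling x} {x | IsNatLabeling x} := by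
  obtain ⟨n, rfl⟩ : ∃ n, s = n + 1 := ⟨s - 1, by omega⟩
  exact (bijOn_label (inter_one r (n + 1) hs)).comp
    ((bijOn_zetaComp hsr L a n le_rfl).comp (bijOn_label (inter_self r (n + 1)).symm))

theorem bijOn_psi_zeta_transferMap (hs : 1 ≤ s) (hsr : s ≤ r) (L : ∀ k, LinExt (mid r s k))
    (a : ℕ → ℝ) (ℓ : ℕ) : Set.BijOn (psi ∘ zeta L a ∘ transferMap)
      (toReal '' planePartitions (trap r s) ℓ) (toReal '' planePartitions (rect r s) ℓ) := by
  have hT : ∀ {x}, psi x ∈ toReal '' planePartitions (trap r s) ℓ ↔ _ :=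
    psi_mem_planePartitions_iff (isTop_trapMax hs hsr)
  have hR : ∀ {x}, psi x ∈ toReal '' planePartitions (rect r s) ℓ ↔ _ :=
    psi_mem_planePartitions_iff (isTop_rectMax hs hsr)
  have hz := bijOn_zeta hs hsr L a
  refine ⟨fun π hπ => ?_, fun π hπ π' hπ' h => ?_, fun σ hσ => ?_⟩
  · rw [← psi_transferMap π, hT] at hπ
    exact hR.2 ⟨hz.mapsTo hπ.1, (psi_zeta_rectMax hs hsr L a _).trans hπ.2⟩
  · rw [← psi_transferMap π, hT] at hπ
    rw [← psi_transferMap π', hT] at hπ'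
    exact transferMap_injective (hz.injOn hπ.1 hπ'.1 (psi_injective h))
  · rw [← psi_transferMap σ, hR] at hσ
    obtain ⟨x, hx, hxσ⟩ := hz.surjOn hσ.1
    refine ⟨psi x, hT.2 ⟨hx, ?_⟩, ?_⟩
    · rw [← psi_zeta_rectMax hs hsr L a, hxσ, hσ.2]
    · rw [Function.comp_apply, Function.comp_apply, transferMap_psi, hxσ, psi_transferMap]

theorem toReal_injective {Q : Type*} : Function.Injective (toReal : (Q → ℕ) → Q → ℝ) :=
  fun _ _ h => funext fun p => Nat.cast_injective (congrFun h p)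

end Bijectivity

end PosetLabeling

end

/-! ### The main theorem. -/

open PosetLabeling

theorem mainTheorem2 (r s : ℕ) (hs : 1 ≤ s) (hrs : s ≤ r)
    (L : ∀ k, LinExt (mid r s k)) (a : ℕ → ℝ) :
    Continuous (psi ∘ zeta L a ∘ transferMap : (trap r s → ℝ) → (rect r s → ℝ)) ∧
    IsPiecewiseLinear (psi ∘ zeta L a ∘ transferMap : (trap r s → ℝ) → (rect r s → ℝ)) ∧
    (∀ ℓ : ℕ, Set.BijOn (psi ∘ zeta L a ∘ transferMap)
      (toReal '' planePartitions (trap r s) ℓ) (toReal '' planePartitions (rect r s) ℓ)) ∧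
    ∀ ℓ : ℕ, (planePartitions (trap r s) ℓ).encard = (planePartitions (rect r s) ℓ).encard := by
  have hpl := isPiecewiseLinear_psi_zeta_transferMap L a
  refine ⟨hpl.continuous, hpl, bijOn_psi_zeta_transferMap hs hrs L a, fun ℓ => ?_⟩
  have h := bijOn_psi_zeta_transferMap hs hrs L a ℓ
  rw [← toReal_injective.encard_image (planePartitions (trap r s) ℓ),
    ← toReal_injective.encard_image (planePartitions (rect r s) ℓ), ← h.image_eq,
    h.injOn.encard_image]
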